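/- **Raĭkov's Theorem.** Let $A$ be a Banach $*$-algebra, i.e. a complex algebra (not necessarily unital or commutative) with an involution $a \mapsto a^*$ (conjugate linear, $(ab)^* = b^*a^*$, $a^{**}=a$; no continuity is assumed) and a complete norm $|\cdot|$ such that $|ab| \le |a|\,|b|$ for all $a,b\in A$. *Notation.* A unit of $A$ is a non-zero two-sided identity element. Put $\widetilde A := A$ if $A$ has a unit, and otherwise let $\widetilde A := \mathbb{C}e \oplus A$ be the unitisation; the spectrum of $a\in A$ is $\operatorname{sp}(a) := \{\lambda\in\mathbb{C} : \lambda e - a \text{ is not invertible in } \widetilde A\}$. The algebra $A$ is called Hermitian if $\operatorname{sp}(a)\subset\mathbb{R}$ for every $a\in A$ with $a^*=a$. For $a\in A$ put $r_\lambda(a) := \inf_{n\ge 1} |a^n|^{1/n}$ and $r_\sigma(a) := r_\lambda(a^*a)^{1/2}$. A state on $A$ is a linear functional $\psi : A\to\mathbb{C}$ such that (a) $\psi(a^*a)\ge 0$ for all $a\in A$; (b) for each $b\in A$, the functional $a\mapsto\psi(b^*ab)$ is continuous on $A_{sa} := \{a\in A : a^*=a\}$; (c) $|\psi(a)|^2\le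 v\,\psi(a^*a)$ for all $a \in A$ and some $v\ge 0$, and the infimum of all such $v$ is $1$. Let $S(A)$ be the set of states on $A$. For $\psi\in S(A)$ let $H_\psi$ be the Hilbert space completion of the quotient of $A$ by the isotropic subspace of the positive semidefinite form $\langle a,b\rangle_\psi := \psi(b^*a)$, and let $\pi_\psi(a)$ be the bounded operator on $H_\psi$ extending the left translation by $a$ (the GNS representation of $\psi$). Let $\pi_u := \bigoplus_{\psi\in S(A)}\pi_\psi$, acting on the Hilbert space direct sum $H_u := \bigoplus_{\psi\in S(A)}H_\psi$, be the universal representation of $A$, and let $\|\pi_u(a)\|$ denote the operator norm of $\pi_u(a)$. For $a\in A$ let $\|a\|_o := \sup_{\psi\in S(A)}\psi(a^*a)^{1/2}$ (the Gelfand-Naĭmark seminorm), with $\|a\|_o := 0$ if $S(A)=\emptyset$. *Claim.* The following statements are equivalent: (i) $A$ is Hermitian; (ii) $\|\pi_u(a)\| = r_\sigma(a)$ for all $a\in A$; (iii) $\|a\|_o = r_\sigma(a)$ for all $a\in A$. -/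

import Mathlib

namespace BanachStar

open scoped ComplexOrder InnerProductSpace


noncomputable section

variable {A : Type*} [NonUnitalNormedRing A] [NormedSpace ℂ A] [IsScalarTower ℂ A A]
  [SMulCommClass ℂ A A] [StarRing A] [StarModule ℂ A]

/-! ### Spectrum, Hermitian algebras, the Pták function -/

/-- A unit of `A`: a non-zero two-sided identity element. -/
def IsUnitElement (e : A) : Prop :=
  e ≠ 0 ∧ ∀ a : A, e * a = a ∧ a * e = a

/-- The spectrum of `a`: the set of complex `z` such that `z e - a` is not invertible in the
unitisation of `A`, where the unitisation of an algebra with unit is the algebra itself, and the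
unitisation of an algebra without unit is `ℂ ⊕ A`. -/
def sp (a : A) : Set ℂ :=
  {z | (∃ e : A, IsUnitElement e ∧ ¬ ∃ b : A, (z • e - a) * b = e ∧ b * (z • e - a) = e) ∨
    ((¬ ∃ e : A, IsUnitElement e) ∧ z ∈ spectrum ℂ (a : Unitization ℂ A))}

variable (A) in
/-- A `*`-algebra is Hermitian if each of its self-adjoint elements has real spectrum. -/
def IsHermitianAlgebra : Prop :=
  ∀ a : A, IsSelfAdjoint a → ∀ z ∈ sp a, z.im = 0

/-- `powSucc a n` is the power `a ^ (n + 1)`. -/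
def powSucc (a : A) : ℕ → A
  | 0 => a
  | n + 1 => powSucc a n * a

/-- `r_λ(a) = inf_{n ≥ 1} ‖a ^ n‖ ^ (1 / n)`. -/
def rLambda (a : A) : ℝ :=
  ⨅ n : ℕ, ‖powSucc a n‖ ^ (1 / ((n : ℝ) + 1))

/-- The Pták function `r_σ(a) = r_λ(a* a) ^ (1 / 2)`. -/
def rSigma (a : A) : ℝ :=
  Real.sqrt (rLambda (star a * a))

/-! ### Positive functionals and states -/

/-- Positivity of a linear functional: `φ(a* a) ≥ 0` for all `a`. -/
def IsPositiveFunctional (φ : A →ₗ[ℂ] ℂ) : Prop :=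
  ∀ a : A, 0 ≤ φ (star a * a)

/-- For each `b`, the functional `a ↦ φ(b* a b)` is continuous on the self-adjoint part. -/
def IsWeaklyContinuousOnSA (φ : A →ₗ[ℂ] ℂ) : Prop :=
  ∀ b : A, ContinuousOn (fun a : A => φ (star b * a * b)) {a : A | IsSelfAdjoint a}

/-- The constants `v ≥ 0` with `|φ(a)|² ≤ v φ(a* a)` for all `a`. -/
def variationBounds (φ : A →ₗ[ℂ] ℂ) : Set ℝ :=
  {v | 0 ≤ v ∧ ∀ a : A, ‖φ a‖ ^ 2 ≤ v * (φ (star a * a)).re}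

/-- A state: a positive linear functional which is weakly continuous on the self-adjoint part and
has finite variation, equal to `1`. -/
structure IsState (ψ : A →ₗ[ℂ] ℂ) : Prop where
  positive : IsPositiveFunctional ψ
  weaklyContinuous : IsWeaklyContinuousOnSA ψ
  finiteVariation : (variationBounds ψ).Nonempty
  variation_eq_one : sInf (variationBounds ψ) = 1

variable (A) in
/-- The set `S(A)` of states, as a type. -/
abbrev State : Type _ := {ψ : A →ₗ[ℂ] ℂ // IsState ψ}

/-- The Gelfand-Naimark seminorm `‖a‖_o = sup_ψ ψ(a* a) ^ (1 / 2)`; the supremum over the empty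
family is `0`. -/
def gnSeminorm (a : A) : ℝ :=
  ⨆ ψ : State A, Real.sqrt (ψ.1 (star a * a)).re

/-! ### The GNS representation of a state -/

theorem IsPositiveFunctional.star_mul_conj {φ : A →ₗ[ℂ] ℂ} (h : IsPositiveFunctional φ) (a b : A) :
    starRingEnd ℂ (φ (star b * a)) = φ (star a * b) := by
  have e1 := (Complex.le_def.1 (h (a + b))).2
  have e2 := (Complex.le_def.1 (h (a + Complex.I • b))).2
  have ea := (Complex.le_def.1 (h a)).2
  have eb := (Complex.le_def.1 (h b)).2
  simp [add_mul, mul_add, smul_mul_assoc, mul_smul_comm, star_smul] at e1 e2 ea eb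
  apply Complex.ext
  · simp; linarith
  · simp; linarith

theorem IsPositiveFunctional.re_nonneg {φ : A →ₗ[ℂ] ℂ} (h : IsPositiveFunctional φ) (a : A) :
    0 ≤ (φ (star a * a)).re :=
  (Complex.le_def.1 (h a)).1

/-- The space `A` with the semi-inner product `(a, b) ↦ ψ(a* b)`, which is conjugate linear in the
first variable. -/
def PreGNS (_ψ : State A) : Type _ := A

namespace PreGNS

instance (ψ : State A) : AddCommGroup (PreGNS ψ) := inferInstanceAs (AddCommGroup A)
instance (ψ : State A) : Module ℂ (PreGNS ψ) := inferInstanceAs (Module ℂ A)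

/-- The identity map from `A` onto the underlying space of `PreGNS ψ`. -/
def of (ψ : State A) : A ≃ₗ[ℂ] PreGNS ψ := LinearEquiv.refl ℂ _

/-- The semi-inner product `(a, b) ↦ ψ(a* b)`. -/
abbrev core (ψ : State A) : PreInnerProductSpace.Core ℂ (PreGNS ψ) where
  inner a b := ψ.1 (star ((of ψ).symm a) * (of ψ).symm b)
  conj_inner_symm a b := ψ.2.positive.star_mul_conj _ _
  re_inner_nonneg a := ψ.2.positive.re_nonneg _
  add_left a b c := by rw [map_add, star_add, add_mul, map_add]
  smul_left a b r := by simp [smul_mul_assoc]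

instance (ψ : State A) : SeminormedAddCommGroup (PreGNS ψ) :=
  InnerProductSpace.Core.toSeminormedAddCommGroup (c := core ψ)

instance (ψ : State A) : InnerProductSpace ℂ (PreGNS ψ) :=
  InnerProductSpace.ofCore (core ψ)

theorem inner_def (ψ : State A) (a b : PreGNS ψ) :
    ⟪a, b⟫_ℂ = ψ.1 (star ((of ψ).symm a) * (of ψ).symm b) := rfl

theorem norm_sq (ψ : State A) (a : PreGNS ψ) :
    ‖a‖ ^ 2 = (ψ.1 (star ((of ψ).symm a) * (of ψ).symm a)).re := by
  rw [← inner_def, ← inner_self_eq_norm_sq (𝕜 := ℂ)]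
  rfl

end PreGNS

theorem tendsto_iterate_sq {x : A} (hx : ‖x‖ < 1) :
    Filter.Tendsto (fun n => (fun y : A => y * y)^[n] x) Filter.atTop (nhds 0) := by
  have hle : ∀ n, ‖(fun y : A => y * y)^[n] x‖ ≤ ‖x‖ ^ (2 ^ n) := by
    intro n
    induction n with
    | zero => simp
    | succ n ih =>
      rw [Function.iterate_succ_apply']
      calc _ ≤ ‖(fun y : A => y * y)^[n] x‖ * ‖(fun y : A => y * y)^[n] x‖ := norm_mul_le _ _
        _ ≤ ‖x‖ ^ (2 ^ n) * ‖x‖ ^ (2 ^ n) := by gcongr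
        _ = _ := by rw [← pow_add]; congr 1; ring
  refine squeeze_zero_norm hle ?_
  exact (tendsto_pow_atTop_nhds_zero_of_lt_one (norm_nonneg x) hx).comp
    (tendsto_pow_atTop_atTop_of_one_lt one_lt_two)

theorem IsState.conj_le_of_norm_lt_one (ψ : State A) (b x : A) (hx : IsSelfAdjoint x)
    (h1 : ‖x‖ < 1) : (ψ.1 (star b * x * b)).re ≤ (ψ.1 (star b * b)).re := by
  by_contra! hlt
  set P := (ψ.1 (star b * b)).re with hP
  have hP0 : 0 ≤ P := ψ.2.positive.re_nonneg b
  set y : ℕ → A := fun n => (fun y : A => y * y)^[n] x with hy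
  have hsa : ∀ n, IsSelfAdjoint (y n) := by
    intro n
    induction n with
    | zero => exact hx
    | succ n ih =>
      simp only [hy, Function.iterate_succ_apply'] at ih ⊢
      rw [IsSelfAdjoint, star_mul, ih.star_eq]
  have hstep : ∀ n, (ψ.1 (star b * y n * b)).re ^ 2 ≤ P * (ψ.1 (star b * y (n + 1) * b)).re := by
    intro n
    have hcs := norm_inner_le_norm (𝕜 := ℂ) (PreGNS.of ψ b) (PreGNS.of ψ (y n * b))
    have h2 : (ψ.1 (star b * y n * b)).re ^ 2 ≤
        (‖PreGNS.of ψ b‖ * ‖PreGNS.of ψ (y n * b)‖) ^ 2 := by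
      rw [PreGNS.inner_def] at hcs
      simp only [LinearEquiv.symm_apply_apply] at hcs
      rw [← mul_assoc] at hcs
      rw [sq_le_sq, abs_of_nonneg (by positivity : 0 ≤ ‖PreGNS.of ψ b‖ * _)]
      exact (Complex.abs_re_le_norm _).trans hcs
    rw [mul_pow, PreGNS.norm_sq, PreGNS.norm_sq] at h2
    simp only [LinearEquiv.symm_apply_apply, star_mul, (hsa n).star_eq] at h2
    have h3 : star b * y (n + 1) * b = star b * y n * (y n * b) := by
      simp only [hy, Function.iterate_succ_apply', mul_assoc]
    rw [h3]
    exact h2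
  have hgt : ∀ n, P < (ψ.1 (star b * y n * b)).re := by
    intro n
    induction n with
    | zero => exact hlt
    | succ n ih =>
      have := hstep n
      rcases hP0.eq_or_lt with h0 | h0
      · rw [← h0] at this ih
        nlinarith
      · by_contra! hle
        nlinarith
  have hlim : Filter.Tendsto (fun n => (ψ.1 (star b * y n * b)).re) Filter.atTop (nhds 0) := by
    have hc := (ψ.2.weaklyContinuous b) 0 (IsSelfAdjoint.zero A)
    have ht : Filter.Tendsto y Filter.atTop (nhdsWithin 0 {a : A | IsSelfAdjoint a}) :=
      tendsto_nhdsWithin_iff.2 ⟨tendsto_iterate_sq h1, Filter.Eventually.of_forall hsa⟩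
    have := Complex.continuous_re.continuousAt.tendsto.comp (hc.tendsto.comp ht)
    simpa [Function.comp_def] using this
  have hPle : P ≤ 0 := ge_of_tendsto' hlim fun n => (hgt n).le
  have hPz : P = 0 := le_antisymm hPle hP0
  have := hstep 0
  have h0 := hgt 0
  rw [hPz] at this h0
  nlinarith

/-- Left multiplication by `a` is bounded for the semi-inner product, uniformly in the state. -/
theorem PreGNS.norm_mul_le (ψ : State A) (a b : A) :
    ‖PreGNS.of ψ (a * b)‖ ≤ Real.sqrt (‖star a * a‖ + 1) * ‖PreGNS.of ψ b‖ := by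
  set c : ℝ := ‖star a * a‖ + 1 with hc
  have hc0 : 0 < c := by positivity
  have key := IsState.conj_le_of_norm_lt_one ψ b (((c⁻¹ : ℝ) : ℂ) • (star a * a))
    (by
      rw [IsSelfAdjoint, star_smul, star_mul, star_star]
      simp)
    (by
      rw [norm_smul, Complex.norm_real, Real.norm_of_nonneg (inv_nonneg.2 hc0.le),
        inv_mul_lt_iff₀ hc0]
      linarith)
  rw [mul_smul_comm, smul_mul_assoc, map_smul, smul_eq_mul, Complex.re_ofReal_mul,
    inv_mul_le_iff₀ hc0] at key
  rw [← sq_le_sq₀ (by positivity) (by positivity), mul_pow, Real.sq_sqrt hc0.le, norm_sq, norm_sq]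
  simp only [LinearEquiv.symm_apply_apply, star_mul]
  rw [show star b * star a * (a * b) = star b * (star a * a) * b by simp only [mul_assoc]]
  exact key

/-- Left multiplication by `a` on the semi-inner product space of `ψ`. -/
def PreGNS.leftMul (ψ : State A) (a : A) : PreGNS ψ →L[ℂ] PreGNS ψ :=
  ((PreGNS.of ψ).toLinearMap ∘ₗ LinearMap.mulLeft ℂ a ∘ₗ (PreGNS.of ψ).symm.toLinearMap).mkContinuous
    (Real.sqrt (‖star a * a‖ + 1)) fun x => PreGNS.norm_mul_le ψ a ((PreGNS.of ψ).symm x)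

theorem PreGNS.leftMul_apply (ψ : State A) (a : A) (x : PreGNS ψ) :
    PreGNS.leftMul ψ a x = PreGNS.of ψ (a * (PreGNS.of ψ).symm x) := rfl

/-- The GNS Hilbert space `H_ψ`: the Hausdorff completion of `A` for the semi-inner product of `ψ`,
that is, the completion of the quotient of `A` by the isotropic subspace. -/
abbrev GNS (ψ : State A) : Type _ := UniformSpace.Completion (PreGNS ψ)

/-- The operator `π_ψ(a)` of the GNS representation: the continuous extension of `b ↦ a b`. -/
def gnsOp (ψ : State A) (a : A) : GNS ψ →L[ℂ] GNS ψ := (PreGNS.leftMul ψ a).completion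

theorem gnsOp_coe (ψ : State A) (a : A) (x : PreGNS ψ) :
    gnsOp ψ a (x : GNS ψ) = ((PreGNS.of ψ (a * (PreGNS.of ψ).symm x) : PreGNS ψ) : GNS ψ) := by
  simp [gnsOp, PreGNS.leftMul_apply]

theorem gnsOp_norm_le (ψ : State A) (a : A) (x : GNS ψ) :
    ‖gnsOp ψ a x‖ ≤ Real.sqrt (‖star a * a‖ + 1) * ‖x‖ := by
  induction x using UniformSpace.Completion.induction_on with
  | hp => exact isClosed_le (by fun_prop) (by fun_prop)
  | ih x =>
    rw [gnsOp_coe, UniformSpace.Completion.norm_coe, UniformSpace.Completion.norm_coe]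
    exact PreGNS.norm_mul_le ψ a ((PreGNS.of ψ).symm x)

theorem gns_ext {ψ : State A} {S T : GNS ψ →L[ℂ] GNS ψ}
    (h : ∀ x : A, S (PreGNS.of ψ x : GNS ψ) = T (PreGNS.of ψ x : GNS ψ)) : S = T := by
  ext x
  induction x using UniformSpace.Completion.induction_on with
  | hp => exact isClosed_eq S.continuous T.continuous
  | ih x => exact h ((PreGNS.of ψ).symm x)

theorem gnsOp_of (ψ : State A) (a x : A) :
    gnsOp ψ a (PreGNS.of ψ x : GNS ψ) = (PreGNS.of ψ (a * x) : GNS ψ) := by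
  rw [gnsOp_coe, LinearEquiv.symm_apply_apply]

theorem gnsOp_smul (ψ : State A) (c : ℂ) (a : A) : gnsOp ψ (c • a) = c • gnsOp ψ a := by
  refine gns_ext fun x => ?_
  rw [smul_apply, gnsOp_of, gnsOp_of, smul_mul_assoc, map_smul,
    UniformSpace.Completion.coe_smul]

theorem gnsOp_add (ψ : State A) (a b : A) : gnsOp ψ (a + b) = gnsOp ψ a + gnsOp ψ b := by
  refine gns_ext fun x => ?_
  rw [add_apply, gnsOp_of, gnsOp_of, gnsOp_of, add_mul, map_add,
    UniformSpace.Completion.coe_add]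

theorem gnsOp_mul (ψ : State A) (a b : A) : gnsOp ψ (a * b) = gnsOp ψ a * gnsOp ψ b := by
  refine gns_ext fun x => ?_
  rw [mul_apply_eq_comp, gnsOp_of, gnsOp_of, gnsOp_of, mul_assoc]

theorem gnsOp_star_inner (ψ : State A) (a : A) (x y : GNS ψ) :
    ⟪gnsOp ψ (star a) x, y⟫_ℂ = ⟪x, gnsOp ψ a y⟫_ℂ := by
  induction x, y using UniformSpace.Completion.induction_on₂ with
  | hp =>
    exact isClosed_eq (((gnsOp ψ (star a)).continuous.comp continuous_fst).inner continuous_snd)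
      (continuous_fst.inner ((gnsOp ψ a).continuous.comp continuous_snd))
  | ih x y =>
    rw [gnsOp_coe, gnsOp_coe, UniformSpace.Completion.inner_coe, UniformSpace.Completion.inner_coe,
      PreGNS.inner_def, PreGNS.inner_def, LinearEquiv.symm_apply_apply,
      LinearEquiv.symm_apply_apply, star_mul, star_star, mul_assoc]

/-- The GNS representation `π_ψ` of a state. -/
def gnsRep (ψ : State A) : A →⋆ₙₐ[ℂ] (GNS ψ →L[ℂ] GNS ψ) where
  toFun := gnsOp ψ
  map_smul' := gnsOp_smul ψ
  map_zero' := by simpa using gnsOp_smul ψ 0 0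
  map_add' := gnsOp_add ψ
  map_mul' := gnsOp_mul ψ
  map_star' a := (ContinuousLinearMap.eq_adjoint_iff _ _).mpr (gnsOp_star_inner ψ a)

/-! ### The universal representation -/

variable (A) in
/-- The universal Hilbert space: the Hilbert space direct sum of the GNS spaces of all states. -/
abbrev UniversalSpace : Type _ := lp (fun ψ : State A => GNS ψ) 2

theorem memlp_gnsRep (a : A) (x : UniversalSpace A) :
    Memℓp (fun ψ : State A => gnsRep ψ a (x ψ)) 2 := by
  refine memℓp_gen ?_
  have hx := (lp.memℓp x).summable (p := 2) (by norm_num)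
  refine Summable.of_nonneg_of_le (fun ψ => by positivity) (fun ψ => ?_)
    (hx.mul_left ((Real.sqrt (‖star a * a‖ + 1)) ^ (2 : ENNReal).toReal))
  rw [← Real.mul_rpow (by positivity) (by positivity)]
  exact Real.rpow_le_rpow (by positivity) (gnsOp_norm_le ψ a (x ψ)) (by positivity)

/-- The direct sum over all states `ψ` of the operators `π_ψ(a)`. -/
def universalOp (a : A) : UniversalSpace A →L[ℂ] UniversalSpace A :=
  LinearMap.mkContinuous
    { toFun := fun x => ⟨fun ψ => gnsRep ψ a (x ψ), memlp_gnsRep a x⟩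
      map_add' := fun x y => by
        ext ψ
        exact map_add (gnsRep ψ a) (x ψ) (y ψ)
      map_smul' := fun c x => by
        ext ψ
        exact map_smul (gnsRep ψ a) c (x ψ) }
    (Real.sqrt (‖star a * a‖ + 1)) fun x => by
      refine lp.norm_le_of_forall_sum_le (by norm_num) (by positivity) fun s => ?_
      rw [Real.mul_rpow (by positivity) (by positivity)]
      refine le_trans (Finset.sum_le_sum fun ψ _ => Real.rpow_le_rpow (by positivity)
        (gnsOp_norm_le ψ a (x ψ)) (by positivity)) ?_
      simp only [Real.mul_rpow (Real.sqrt_nonneg _) (norm_nonneg _)]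
      rw [← Finset.mul_sum]
      exact mul_le_mul_of_nonneg_left (lp.sum_rpow_le_norm_rpow (by norm_num) x s) (by positivity)

theorem universalOp_apply (a : A) (x : UniversalSpace A) (ψ : State A) :
    universalOp a x ψ = gnsRep ψ a (x ψ) := rfl

variable (A) in
/-- The universal representation `π_u`, the direct sum of the GNS representations of all states. -/
def universalRep : A →⋆ₙₐ[ℂ] (UniversalSpace A →L[ℂ] UniversalSpace A) where
  toFun := universalOp
  map_smul' c a := by
    ext x ψ
    exact congrArg (fun T : GNS ψ →L[ℂ] GNS ψ => T (x ψ)) (map_smul (gnsRep ψ) c a)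
  map_zero' := by
    ext x ψ
    exact congrArg (fun T : GNS ψ →L[ℂ] GNS ψ => T (x ψ)) (map_zero (gnsRep ψ))
  map_add' a b := by
    ext x ψ
    exact congrArg (fun T : GNS ψ →L[ℂ] GNS ψ => T (x ψ)) (map_add (gnsRep ψ) a b)
  map_mul' a b := by
    ext x ψ
    exact congrArg (fun T : GNS ψ →L[ℂ] GNS ψ => T (x ψ)) (map_mul (gnsRep ψ) a b)
  map_star' a := by
    refine (ContinuousLinearMap.eq_adjoint_iff _ _).mpr fun x y => ?_
    rw [lp.inner_eq_tsum, lp.inner_eq_tsum]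
    refine tsum_congr fun ψ => ?_
    rw [universalOp_apply, universalOp_apply, map_star, ContinuousLinearMap.star_eq_adjoint,
      ContinuousLinearMap.adjoint_inner_left]

end

end BanachStar

/-!
Let `ρ` be the spectral radius in the unitization, which is `r_λ` by Gelfand's formula.

If `A` is Hermitian, Ford's square root `√(1 - h)` of self-adjoint elements with `ρ(h) < 1` (which
needs no continuity of the involution) yields Pták's inequality `ρ(a)² ≤ ρ(a* a)`. It makes the
largest spectral value sublinear on the self-adjoint part and, by the Shirali–Ford argument,
makes the spectrum of every `a* a` non-negative. Hence Hahn–Banach extends the point evaluation at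
`a* a` of its largest spectral value to a positive functional, and its restriction to `A` is a
multiple of a state; this gives `r_σ(a) ≤ ‖a‖_o`. The reverse inequality holds for every
representation on a Hilbert space, because there the norm of a self-adjoint operator is its
spectral radius and representations shrink spectra.

Conversely, let `r_λ(k) ≤ ‖π(k)‖` for all self-adjoint `k`, and let `z = r + i s`, `s ≠ 0`, be a
spectral value of a self-adjoint `h`. For small `c > 0` the elements `h (1 - c (h - r)²) ^ m` have
images under `π` of norm at most `‖π(h)‖`, yet `z (1 + c s²) ^ m` lies in their spectra.
-/

namespace BanachStar

open Polynomial Filter Topology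
open scoped ComplexOrder ComplexStarModule InnerProductSpace Pointwise

section SpectralRadius

variable {B : Type*} [NormedRing B] [NormedAlgebra ℂ B]

/-- The spectral radius as a real number, which loses nothing since it is finite in a Banach
algebra. -/
noncomputable def specRad (a : B) : ℝ :=
  (spectralRadius ℂ a).toReal

theorem specRad_nonneg (a : B) : 0 ≤ specRad a :=
  ENNReal.toReal_nonneg

theorem specRad_le {a : B} {R : ℝ} (hR : 0 ≤ R) (h : ∀ z ∈ spectrum ℂ a, ‖z‖ ≤ R) :
    specRad a ≤ R := by
  lift R to NNReal using hR
  exact ENNReal.toReal_le_coe_of_le_coe (iSup₂_le fun z hz => by exact_mod_cast h z hz)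

variable [CompleteSpace B]

theorem spectralRadius_ne_top (a : B) : spectralRadius ℂ a ≠ ⊤ := by
  refine ne_top_of_le_ne_top ?_ (spectrum.spectralRadius_le_pow_nnnorm_pow_one_div ℂ a 0)
  finiteness

theorem norm_le_specRad {a : B} {z : ℂ} (hz : z ∈ spectrum ℂ a) : ‖z‖ ≤ specRad a := by
  have h : (‖z‖₊ : ENNReal) ≤ spectralRadius ℂ a :=
    le_iSup₂ (f := fun (k : ℂ) (_ : k ∈ spectrum ℂ a) => (‖k‖₊ : ENNReal)) z hz
  exact ENNReal.toReal_mono (spectralRadius_ne_top a) h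

theorem exists_norm_eq_specRad [Nontrivial B] (a : B) : ∃ z ∈ spectrum ℂ a, ‖z‖ = specRad a := by
  obtain ⟨z, hz, hr⟩ := spectrum.exists_nnnorm_eq_spectralRadius a
  exact ⟨z, hz, by simp [specRad, ← hr]⟩

theorem specRad_le_norm_mul (a : B) : specRad a ≤ ‖a‖ * ‖(1 : B)‖ :=
  specRad_le (by positivity) fun _ hz => spectrum.norm_le_norm_mul_of_mem hz

theorem specRad_mul_comm (a b : B) : specRad (a * b) = specRad (b * a) := by
  suffices h : ∀ a b : B, specRad (a * b) ≤ specRad (b * a) from le_antisymm (h a b) (h b a)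
  refine fun a b => specRad_le (specRad_nonneg _) fun z hz => ?_
  rcases eq_or_ne z 0 with rfl | hz0
  · simpa using specRad_nonneg (b * a)
  · have hz' : z ∈ spectrum ℂ (a * b) \ {0} := ⟨hz, hz0⟩
    rw [spectrum.nonzero_mul_comm] at hz'
    exact norm_le_specRad hz'.1

theorem specRad_star [StarRing B] [StarModule ℂ B] (a : B) : specRad (star a) = specRad a := by
  suffices h : ∀ a : B, specRad (star a) ≤ specRad a from
    le_antisymm (h a) (by simpa using h (star a))
  refine fun a => specRad_le (specRad_nonneg a) fun z hz => ?_
  rw [spectrum.map_star, Set.mem_star] at hz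
  simpa using norm_le_specRad hz

theorem specRad_smul [Nontrivial B] (c : ℂ) (a : B) : specRad (c • a) = ‖c‖ * specRad a := by
  have hσ := spectrum.smul_eq_smul c a (spectrum.nonempty a)
  apply le_antisymm
  · refine specRad_le (by have := specRad_nonneg a; positivity) fun z hz => ?_
    rw [hσ] at hz
    obtain ⟨w, hw, rfl⟩ := hz
    simpa using mul_le_mul_of_nonneg_left (norm_le_specRad hw) (norm_nonneg c)
  · obtain ⟨z, hz, hza⟩ := exists_norm_eq_specRad a
    rw [← hza, ← norm_smul]
    exact norm_le_specRad (hσ ▸ Set.smul_mem_smul_set hz)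

theorem specRad_pow [Nontrivial B] (a : B) (n : ℕ) : specRad (a ^ n) = specRad a ^ n := by
  apply le_antisymm
  · refine specRad_le (pow_nonneg (specRad_nonneg a) n) fun z hz => ?_
    rw [spectrum.map_pow] at hz
    obtain ⟨w, hw, rfl⟩ := hz
    simpa using pow_le_pow_left₀ (norm_nonneg w) (norm_le_specRad hw) n
  · obtain ⟨z, hz, hza⟩ := exists_norm_eq_specRad a
    rw [← hza, ← norm_pow]
    exact norm_le_specRad (spectrum.pow_mem_pow a n hz)

theorem isUnit_one_sub_of_specRad_lt_one {a : B} (h : specRad a < 1) : IsUnit (1 - a) := by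
  by_contra hn
  have h1 : (1 : ℂ) ∈ spectrum ℂ a := by rwa [spectrum.mem_iff, map_one]
  simpa using (norm_le_specRad h1).trans_lt h

theorem tendsto_norm_pow_root_specRad (a : B) :
    Tendsto (fun n : ℕ => ‖a ^ n‖ ^ (1 / n : ℝ)) atTop (𝓝 (specRad a)) := by
  have h := (ENNReal.tendsto_toReal (spectralRadius_ne_top a)).comp
    (spectrum.pow_norm_pow_one_div_tendsto_nhds_spectralRadius a)
  refine h.congr fun n => ENNReal.toReal_ofReal (by positivity)

theorem exists_norm_pow_le {a : B} {θ : ℝ} (h : specRad a < θ) :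
    ∃ M : ℝ, 0 ≤ M ∧ ∀ n : ℕ, ‖a ^ n‖ ≤ M * θ ^ n := by
  have hθ : 0 < θ := (specRad_nonneg a).trans_lt h
  have hle : ∀ᶠ n : ℕ in atTop, ‖a ^ n‖ ≤ 1 * ‖θ ^ n‖ := by
    filter_upwards [(tendsto_norm_pow_root_specRad a).eventually_lt_const h,
      eventually_ne_atTop 0] with n hn hn0
    have := pow_le_pow_left₀ (by positivity) hn.le n
    rw [one_div, Real.rpow_inv_natCast_pow (norm_nonneg _) hn0] at this
    rwa [one_mul, Real.norm_of_nonneg (by positivity)]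
  have hO : (fun n : ℕ => a ^ n) =O[atTop] fun n : ℕ => θ ^ n := .of_bound 1 hle
  rw [Asymptotics.isBigO_nat_atTop_iff fun n hn => absurd hn (pow_pos hθ n).ne'] at hO
  obtain ⟨M, hM⟩ := hO
  refine ⟨max M 0, le_max_right _ _, fun n => (hM n).trans ?_⟩
  rw [Real.norm_of_nonneg (by positivity)]
  gcongr
  exact le_max_left _ _

theorem specRad_le_of_norm_pow_le {a : B} {θ M : ℝ} (hθ : 0 ≤ θ)
    (h : ∀ n : ℕ, ‖a ^ n‖ ≤ M * θ ^ n) : specRad a ≤ θ := by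
  have hroot : Tendsto (fun n : ℕ => max M 1 ^ (1 / n : ℝ) * θ) atTop (𝓝 (1 * θ)) := by
    have h0 := (tendsto_const_nhds (x := max M 1)).rpow tendsto_one_div_atTop_nhds_zero_nat
      (.inl (by positivity))
    simpa using h0.mul_const θ
  rw [← one_mul θ]
  refine le_of_tendsto_of_tendsto (tendsto_norm_pow_root_specRad a) hroot ?_
  filter_upwards [eventually_ne_atTop 0] with n hn
  calc ‖a ^ n‖ ^ (1 / n : ℝ) ≤ (max M 1 * θ ^ n) ^ (1 / n : ℝ) := by
        gcongr
        exact (h n).trans (by gcongr; exact le_max_left M 1)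
    _ = max M 1 ^ (1 / n : ℝ) * θ := by
        rw [Real.mul_rpow (by positivity) (by positivity), one_div,
          Real.pow_rpow_inv_natCast hθ hn]

theorem norm_add_pow_le_of_commute {R : Type*} [NormedRing R] {a b : R} (hab : Commute a b)
    {M N θ η : ℝ} (hM : 0 ≤ M) (hθ : 0 ≤ θ) (ha : ∀ n : ℕ, ‖a ^ n‖ ≤ M * θ ^ n)
    (hb : ∀ n : ℕ, ‖b ^ n‖ ≤ N * η ^ n) (n : ℕ) :
    ‖(a + b) ^ n‖ ≤ M * N * (θ + η) ^ n := by
  rw [hab.add_pow, add_pow, Finset.mul_sum]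
  refine norm_sum_le_of_le _ fun m _ => ?_
  calc ‖a ^ m * b ^ (n - m) * (n.choose m : R)‖
      ≤ n.choose m * ‖a ^ m * b ^ (n - m)‖ := by rw [← nsmul_eq_mul']; exact norm_nsmul_le
    _ ≤ n.choose m * ((M * θ ^ m) * (N * η ^ (n - m))) := by
        gcongr
        refine (norm_mul_le _ _).trans ?_
        gcongr
        exacts [ha m, hb _]
    _ = M * N * (θ ^ m * η ^ (n - m) * n.choose m) := by ring

theorem specRad_add_le_of_commute {a b : B} (hab : Commute a b) :
    specRad (a + b) ≤ specRad a + specRad b := by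
  refine le_of_forall_pos_le_add fun ε hε => ?_
  obtain ⟨M, hM0, hM⟩ := exists_norm_pow_le (show specRad a < specRad a + ε / 2 by linarith)
  obtain ⟨N, -, hN⟩ := exists_norm_pow_le (show specRad b < specRad b + ε / 2 by linarith)
  have ha := specRad_nonneg a
  have hb := specRad_nonneg b
  have h := specRad_le_of_norm_pow_le (by positivity)
    (norm_add_pow_le_of_commute hab hM0 (by positivity) hM hN)
  linarith

end SpectralRadius

section SquareRoot

/-- Picard iterates for the equation `y = x + y ^ 2`, whose solution gives the square root `1 - 2 y`
of `1 - 4 x`. Their coefficients are natural numbers, so that a bound for the iterates at a positive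
real number bounds them in a Banach algebra. -/
noncomputable def sqrtIter : ℕ → ℕ[X]
  | 0 => 0
  | n + 1 => X + sqrtIter n ^ 2

theorem aeval_natPolynomial_nonneg (p : ℕ[X]) {ρ : ℝ} (hρ : 0 ≤ ρ) : 0 ≤ aeval ρ p := by
  rw [aeval_eq_sum_range]
  exact Finset.sum_nonneg fun i _ => by positivity

theorem aeval_sqrtIter_le {ρ : ℝ} (h0 : 0 ≤ ρ) (h1 : ρ ≤ 1 / 4) (n : ℕ) :
    aeval ρ (sqrtIter n) ≤ ρ + 1 / 4 := by
  induction n with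
  | zero => simp only [sqrtIter, map_zero]; positivity
  | succ n ih =>
    have hpos := aeval_natPolynomial_nonneg (sqrtIter n) h0
    simp only [sqrtIter, map_add, map_pow, aeval_X]
    nlinarith

theorem exists_sqrtIter_succ_eq_add {ρ : ℝ} (h0 : 0 ≤ ρ) (h1 : ρ ≤ 1 / 4) (n : ℕ) :
    ∃ d : ℕ[X], sqrtIter (n + 1) = sqrtIter n + d ∧ aeval ρ d ≤ ρ * (2 * (ρ + 1 / 4)) ^ n := by
  induction n with
  | zero => exact ⟨X, by simp [sqrtIter], by simp⟩
  | succ n ih =>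
    obtain ⟨d, hd, hdρ⟩ := ih
    refine ⟨d * (sqrtIter (n + 1) + sqrtIter n), ?_, ?_⟩
    · calc sqrtIter (n + 2) = X + (sqrtIter n + d) ^ 2 := by rw [sqrtIter, hd]
        _ = (X + sqrtIter n ^ 2) + d * ((sqrtIter n + d) + sqrtIter n) := by ring
        _ = sqrtIter (n + 1) + d * (sqrtIter (n + 1) + sqrtIter n) := by rw [← hd, sqrtIter]
    · have hn := aeval_natPolynomial_nonneg (sqrtIter n) h0
      have hn' := aeval_natPolynomial_nonneg (sqrtIter (n + 1)) h0
      rw [map_mul, map_add, pow_succ, ← mul_assoc]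
      gcongr
      linarith [aeval_sqrtIter_le h0 h1 n, aeval_sqrtIter_le h0 h1 (n + 1)]

variable {B : Type*} [NormedRing B] [NormedAlgebra ℂ B]

theorem norm_aeval_natPolynomial_le {R : Type*} [NormedRing R] {x : R} {M ρ : ℝ}
    (hx : ∀ n : ℕ, ‖x ^ n‖ ≤ M * ρ ^ n) (p : ℕ[X]) : ‖aeval x p‖ ≤ M * aeval ρ p := by
  rw [aeval_eq_sum_range, aeval_eq_sum_range, Finset.mul_sum]
  refine norm_sum_le_of_le _ fun i _ => ?_
  calc ‖p.coeff i • x ^ i‖ ≤ (p.coeff i : ℝ) * ‖x ^ i‖ := norm_nsmul_le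
    _ ≤ p.coeff i * (M * ρ ^ i) := by gcongr; exact hx i
    _ = M * (p.coeff i • ρ ^ i) := by rw [nsmul_eq_mul]; ring

theorem exists_tendsto_aeval_sqrtIter {R : Type*} [NormedRing R] [CompleteSpace R] {x : R}
    {M ρ : ℝ} (hM : 0 ≤ M) (h0 : 0 ≤ ρ) (h1 : ρ < 1 / 4) (hx : ∀ n : ℕ, ‖x ^ n‖ ≤ M * ρ ^ n) :
    ∃ y, Tendsto (fun n => aeval x (sqrtIter n)) atTop (𝓝 y) := by
  refine cauchySeq_tendsto_of_complete
    (cauchySeq_of_le_geometric (2 * (ρ + 1 / 4)) (M * ρ) (by linarith) fun n => ?_)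
  obtain ⟨d, hd, hdρ⟩ := exists_sqrtIter_succ_eq_add h0 h1.le n
  rw [dist_comm, dist_eq_norm, hd, map_add, add_sub_cancel_left, mul_assoc]
  exact (norm_aeval_natPolynomial_le hx d).trans (by gcongr)

variable [CompleteSpace B]

theorem exists_eq_add_sq {x : B} (hx : specRad x < 1 / 4) :
    ∃ y : B, y = x + y ^ 2 ∧ specRad y < 1 / 2 ∧ ∀ w, Commute x w → Commute y w := by
  obtain ⟨ρ, hxρ, hρ⟩ := exists_between hx
  have h0 : 0 ≤ ρ := (specRad_nonneg x).trans hxρ.le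
  obtain ⟨M, hM0, hM⟩ := exists_norm_pow_le hxρ
  obtain ⟨y, hy⟩ := exists_tendsto_aeval_sqrtIter hM0 h0 hρ hM
  have hsucc (n : ℕ) : aeval x (sqrtIter (n + 1)) = x + aeval x (sqrtIter n) ^ 2 := by
    simp [sqrtIter]
  refine ⟨y, ?fixed, ?radius, fun w hw => ?commute⟩
  case fixed =>
    refine tendsto_nhds_unique (hy.comp (tendsto_add_atTop_nat 1)) ?_
    simpa only [Function.comp_def, hsucc] using (hy.pow 2).const_add x
  case radius =>
    suffices h : specRad y ≤ ρ + 1 / 4 by linarith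
    refine specRad_le_of_norm_pow_le (M := M) (by positivity) fun m => ?_
    refine le_of_tendsto' (hy.pow m).norm fun n => ?_
    rw [← map_pow]
    refine (norm_aeval_natPolynomial_le hM _).trans ?_
    rw [map_pow]
    gcongr
    · exact aeval_natPolynomial_nonneg _ h0
    · exact aeval_sqrtIter_le h0 hρ.le n
  case commute =>
    have hcomm (n : ℕ) : Commute (aeval x (sqrtIter n)) w := by
      induction n with
      | zero => simp [sqrtIter]
      | succ n ih => rw [hsucc]; exact hw.add_left (ih.pow_left 2)
    exact tendsto_nhds_unique (hy.mul_const w) (by simpa only [(hcomm _).eq] using hy.const_mul w)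

variable [StarRing B] [StarModule ℂ B]

/- The involution is not assumed continuous, so `y` does not inherit self-adjointness from the
polynomials converging to it; instead `y` and `star y` are two small solutions of the same quadratic
equation. -/
theorem isSelfAdjoint_of_eq_add_sq {x y : B} (hx : IsSelfAdjoint x) (hy : y = x + y ^ 2)
    (hyr : specRad y < 1 / 2) (hcomm : ∀ w, Commute x w → Commute y w) : IsSelfAdjoint y := by
  have hsy : star y = x + star y ^ 2 := by
    simpa only [star_add, star_pow, hx.star_eq] using congrArg star hy
  have hxy : Commute x (star y) := by
    simpa only [hx.star_eq] using (hcomm x (Commute.refl x)).symm.star_star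
  have hc : Commute y (star y) := hcomm _ hxy
  have hu : IsUnit (1 - (y + star y)) := by
    refine isUnit_one_sub_of_specRad_lt_one ?_
    linarith [specRad_add_le_of_commute hc, specRad_star y]
  have hzero : (y - star y) * (1 - (y + star y)) = 0 :=
    calc (y - star y) * (1 - (y + star y))
        = (y - y ^ 2) - (star y - star y ^ 2) + (star y * y - y * star y) := by noncomm_ring
      _ = 0 := by rw [sub_eq_of_eq_add hy, sub_eq_of_eq_add hsy, hc.eq]; simp
  exact (sub_eq_zero.1 (hu.mul_left_eq_zero.1 hzero)).symm

theorem exists_isSelfAdjoint_sq_eq_one_sub [Nontrivial B] {x : B} (hx : IsSelfAdjoint x)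
    (hxr : specRad x < 1) : ∃ s : B, IsSelfAdjoint s ∧ s * s = 1 - x := by
  have hx' : IsSelfAdjoint ((4⁻¹ : ℂ) • x) := by
    rw [IsSelfAdjoint, star_smul, hx.star_eq]; simp
  obtain ⟨y, hy, hyr, hcomm⟩ := exists_eq_add_sq (x := (4⁻¹ : ℂ) • x) (by
    rw [specRad_smul]; norm_num; linarith)
  have hys := isSelfAdjoint_of_eq_add_sq hx' hy hyr hcomm
  refine ⟨1 - (y + y), (IsSelfAdjoint.one B).sub (hys.add hys), ?_⟩
  have hx4 : x = (4 : ℂ) • (y - y ^ 2) := by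
    rw [sub_eq_of_eq_add hy, smul_smul]; norm_num
  rw [hx4, ofNat_smul_eq_nsmul ℂ 4]
  noncomm_ring

end SquareRoot

section Spectrum

variable {K R : Type*} [CommRing K] [Ring R] [Algebra K R] {a : R}

theorem isUnit_one_add_iff_neg_one_notMem : IsUnit (1 + a) ↔ (-1 : K) ∉ spectrum K a := by
  rw [spectrum.notMem_iff, map_neg, map_one, ← neg_add', IsUnit.neg_iff]

theorem mem_spectrum_algebraMap_sub_iff {c z : K} :
    z ∈ spectrum K (algebraMap K R c - a) ↔ c - z ∈ spectrum K a := by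
  rw [spectrum.mem_iff, spectrum.mem_iff, ← IsUnit.neg_iff, map_sub]
  congr! 2
  abel

theorem mem_spectrum_one_add_iff {z : K} : z ∈ spectrum K (1 + a) ↔ z - 1 ∈ spectrum K a := by
  rw [spectrum.mem_iff, spectrum.mem_iff, map_sub, map_one, sub_sub]

theorem mem_spectrum_one_sub_iff {z : K} : z ∈ spectrum K (1 - a) ↔ 1 - z ∈ spectrum K a := by
  simpa only [map_one] using mem_spectrum_algebraMap_sub_iff (R := R) (c := (1 : K)) (z := z)

theorem spectrum_mul_one_sub_pow {F : Type*} [Field F] [IsAlgClosed F] [Algebra F R]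
    (ha : (spectrum F a).Nonempty) (n : ℕ) :
    spectrum F (a * (1 - a) ^ n) = (fun z => z * (1 - z) ^ n) '' spectrum F a := by
  have hmap := spectrum.map_polynomial_aeval_of_nonempty a ((X : F[X]) * (1 - X) ^ n) ha
  rw [aeval_mul, map_pow, map_sub, map_one, aeval_X] at hmap
  simpa using hmap

end Spectrum

section RealSpectrum

variable {B : Type*} [Ring B] [Algebra ℂ B]

/-- Nonnegativity of the spectrum, meant for elements with real spectrum; it is tested on the real
parts of the spectral values. -/
def SpectrumNonneg (h : B) : Prop :=
  ∀ z ∈ spectrum ℂ h, 0 ≤ z.re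

variable (B) in
/-- The self-adjoint elements of a unital `*`-algebra have real spectrum. For unital algebras this
is `IsHermitianAlgebra`, with the unit taken from the ring structure. -/
def HasRealSpectra [Star B] : Prop :=
  ∀ h : B, IsSelfAdjoint h → ∀ z ∈ spectrum ℂ h, z.im = 0

theorem HasRealSpectra.eq_ofReal [Star B] (hB : HasRealSpectra B) {h : B} (hh : IsSelfAdjoint h)
    {z : ℂ} (hz : z ∈ spectrum ℂ h) : z = z.re :=
  Complex.ext rfl (hB h hh z hz)

theorem SpectrumNonneg.smul {h : B} (hh : SpectrumNonneg h) {c : ℝ} (hc : 0 < c) :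
    SpectrumNonneg (c • h) := by
  intro z hz
  have hc' : (c : ℂ) ≠ 0 := by exact_mod_cast hc.ne'
  rw [← Complex.coe_smul, ← Units.val_mk0 hc', ← Units.smul_def, spectrum.unit_smul_eq_smul] at hz
  obtain ⟨w, hw, rfl⟩ := hz
  simpa [Units.smul_def] using mul_nonneg hc.le (hh w hw)

theorem SpectrumNonneg.one_sub_mul_comm {a b : B}
    (h : SpectrumNonneg (1 - a * b)) : SpectrumNonneg (1 - b * a) := by
  intro z hz
  rw [mem_spectrum_one_sub_iff] at hz
  by_cases h0 : 1 - z = 0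
  · simp [← sub_eq_zero.1 h0]
  · have hz' : 1 - z ∈ spectrum ℂ (b * a) \ {0} := ⟨hz, h0⟩
    rw [spectrum.nonzero_mul_comm] at hz'
    exact h z (mem_spectrum_one_sub_iff.2 hz'.1)

theorem HasRealSpectra.isUnit_one_add_of_star_eq_neg [StarRing B] [StarModule ℂ B]
    (hB : HasRealSpectra B) {k : B} (hk : star k = -k) :
    IsUnit (1 + k) := by
  have hsa : IsSelfAdjoint (Complex.I • k) := by
    rw [IsSelfAdjoint, star_smul, hk]; simp
  refine (isUnit_one_add_iff_neg_one_notMem (K := ℂ)).2 fun hmem => ?_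
  have hI : (Units.mk0 Complex.I Complex.I_ne_zero) • (-1 : ℂ) ∈ spectrum ℂ (Complex.I • k) :=
    spectrum.smul_mem_smul_iff.2 hmem
  simpa [Units.smul_def] using hB _ hsa _ hI

end RealSpectrum

section Ptak

variable {B : Type*} [NormedRing B] [NormedAlgebra ℂ B] [StarRing B] [StarModule ℂ B]
  [CompleteSpace B] [Nontrivial B]

/- With `s ^ 2 = 1 - star a * a`, the product is `s (1 + k) s` for the skew-adjoint element
`k = s⁻¹ (star a - a) s⁻¹`. -/
theorem HasRealSpectra.isUnit_one_add_star_mul_one_sub (hB : HasRealSpectra B) {a : B}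
    (ha : specRad (star a * a) < 1) : IsUnit ((1 + star a) * (1 - a)) := by
  obtain ⟨s, hs, hss⟩ := exists_isSelfAdjoint_sq_eq_one_sub (IsSelfAdjoint.star_mul_self a) ha
  have hu : IsUnit s := by
    have h := isUnit_one_sub_of_specRad_lt_one ha
    rw [← hss, ← sq] at h
    exact (isUnit_pow_iff two_ne_zero).1 h
  obtain ⟨u, rfl⟩ := hu
  have hinv : star (↑u⁻¹ : B) = ↑u⁻¹ := by
    simpa only [Ring.inverse_unit] using hs.ringInverse.star_eq
  have hk : IsUnit (1 + ↑u⁻¹ * (star a - a) * ↑u⁻¹ : B) := by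
    refine hB.isUnit_one_add_of_star_eq_neg ?_
    rw [star_mul, star_mul, hinv, star_sub, star_star]
    noncomm_ring
  have hfactor : (1 + star a) * (1 - a) = u * (1 + ↑u⁻¹ * (star a - a) * ↑u⁻¹) * u :=
    calc (1 + star a) * (1 - a) = (1 - star a * a) + (star a - a) := by noncomm_ring
      _ = u * u + (star a - a) := by rw [hss]
      _ = u * (1 + ↑u⁻¹ * (star a - a) * ↑u⁻¹) * u := by
        simp only [mul_add, add_mul, mul_one, mul_assoc, Units.inv_mul, Units.mul_inv_cancel_left]
  rw [hfactor]
  exact (u.isUnit.mul hk).mul u.isUnit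

theorem HasRealSpectra.isUnit_one_sub (hB : HasRealSpectra B) {a : B}
    (ha : specRad (star a * a) < 1) : IsUnit (1 - a) := by
  obtain ⟨u, hu⟩ := hB.isUnit_one_add_star_mul_one_sub ha
  obtain ⟨v, hv⟩ := hB.isUnit_one_add_star_mul_one_sub (a := -star a)
    (by simpa [specRad_mul_comm a] using ha)
  rw [star_neg, star_star, ← sub_eq_add_neg, sub_neg_eq_add] at hv
  exact isUnit_iff_exists_and_exists.2
    ⟨⟨(1 + star a) * ↑v⁻¹, by rw [← mul_assoc, ← hv, Units.mul_inv]⟩,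
      ⟨↑u⁻¹ * (1 + star a), by rw [mul_assoc, ← hu, Units.inv_mul]⟩⟩

theorem HasRealSpectra.specRad_sq_le (hB : HasRealSpectra B) (a : B) :
    specRad a ^ 2 ≤ specRad (star a * a) := by
  obtain ⟨z, hz, hza⟩ := exists_norm_eq_specRad a
  rw [← hza]
  by_contra! hlt
  have hz0 : z ≠ 0 := by
    rintro rfl
    exact absurd hlt (by simpa using specRad_nonneg (star a * a))
  have hu : IsUnit (1 - z⁻¹ • a) := by
    refine hB.isUnit_one_sub ?_
    rw [star_smul, smul_mul_smul_comm, specRad_smul, norm_mul, norm_star, norm_inv, ← sq, inv_pow,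
      inv_mul_lt_iff₀ (by positivity), mul_one]
    exact hlt
  have h1 : (1 : ℂ) ∈ spectrum ℂ (z⁻¹ • a) := by
    rw [spectrum.smul_eq_smul _ _ (spectrum.nonempty a)]
    exact ⟨z, hz, inv_mul_cancel₀ hz0⟩
  rw [spectrum.mem_iff, map_one] at h1
  exact h1 hu

/- Pták's inequality turns the radius of `h k` into that of `h ^ 2 k ^ 2`; iterating, Gelfand's
formula applies to the two factors separately. -/
theorem HasRealSpectra.specRad_mul_le (hB : HasRealSpectra B) {h k : B} (hh : IsSelfAdjoint h)
    (hk : IsSelfAdjoint k) : specRad (h * k) ≤ specRad h * specRad k := by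
  have hpow (n : ℕ) : specRad (h * k) ^ 2 ^ n ≤ specRad (h ^ 2 ^ n * k ^ 2 ^ n) := by
    induction n with
    | zero => simp
    | succ n ih =>
      set x := h ^ 2 ^ n
      set y := k ^ 2 ^ n
      have hxy : star (x * y) * (x * y) = y * (x ^ 2 * y) := by
        rw [star_mul, (hh.pow _).star_eq, (hk.pow _).star_eq]; noncomm_ring
      calc specRad (h * k) ^ 2 ^ (n + 1) = (specRad (h * k) ^ 2 ^ n) ^ 2 := by ring
        _ ≤ specRad (x * y) ^ 2 := pow_le_pow_left₀ (pow_nonneg (specRad_nonneg _) _) ih 2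
        _ ≤ specRad (y * (x ^ 2 * y)) := hxy ▸ hB.specRad_sq_le (x * y)
        _ = specRad (h ^ 2 ^ (n + 1) * k ^ 2 ^ (n + 1)) := by
          rw [specRad_mul_comm, mul_assoc, ← sq, pow_succ 2 n, pow_mul h, pow_mul k]
  have hle (n : ℕ) : specRad (h * k) ≤ ‖h ^ 2 ^ n‖ ^ (1 / (2 ^ n : ℕ) : ℝ) *
      ‖k ^ 2 ^ n‖ ^ (1 / (2 ^ n : ℕ) : ℝ) * ‖(1 : B)‖ ^ (1 / (2 ^ n : ℕ) : ℝ) := by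
    rw [← Real.mul_rpow (by positivity) (by positivity),
      ← Real.mul_rpow (by positivity) (by positivity), one_div, Real.le_rpow_inv_iff_of_pos
      (specRad_nonneg _) (by positivity) (by positivity), Real.rpow_natCast]
    refine (hpow n).trans ((specRad_le_norm_mul _).trans ?_)
    gcongr
    exact norm_mul_le _ _
  have hN : Tendsto (fun n : ℕ => 2 ^ n) atTop atTop := tendsto_pow_atTop_atTop_of_one_lt one_lt_two
  have hone : Tendsto (fun n : ℕ => ‖(1 : B)‖ ^ (1 / n : ℝ)) atTop (𝓝 1) := by
    simpa using (tendsto_const_nhds (x := ‖(1 : B)‖)).rpow tendsto_one_div_atTop_nhds_zero_nat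
      (.inl (norm_ne_zero_iff.2 one_ne_zero))
  have hlim := (((tendsto_norm_pow_root_specRad h).mul (tendsto_norm_pow_root_specRad k)).mul
    hone).comp hN
  rw [mul_one] at hlim
  exact ge_of_tendsto' hlim hle

end Ptak

section Order

variable {B : Type*} [NormedRing B] [NormedAlgebra ℂ B] [StarRing B] [CompleteSpace B]
  [Nontrivial B]

theorem HasRealSpectra.exists_unit_eq_one_add (hB : HasRealSpectra B) {h : B}
    (hh : IsSelfAdjoint h) (h0 : SpectrumNonneg h) :
    ∃ u : Bˣ, (u : B) = 1 + h ∧ IsSelfAdjoint (1 - ↑u⁻¹ : B) ∧ specRad (1 - ↑u⁻¹ : B) < 1 := by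
  obtain ⟨u, hu⟩ : IsUnit (1 + h) :=
    (isUnit_one_add_iff_neg_one_notMem (K := ℂ)).2 fun hmem => by
      simpa using (h0 _ hmem).trans_lt neg_one_lt_zero
  have husa : IsSelfAdjoint (u : B) := hu ▸ (IsSelfAdjoint.one B).add hh
  refine ⟨u, hu, (IsSelfAdjoint.one B).sub (by simpa using husa.ringInverse), ?_⟩
  obtain ⟨z, hz, hzr⟩ := exists_norm_eq_specRad (1 - ↑u⁻¹ : B)
  rw [mem_spectrum_one_sub_iff, ← spectrum.map_inv, Set.mem_inv, hu,
    mem_spectrum_one_add_iff] at hz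
  set t := (1 - z)⁻¹ - 1 with ht
  have ht0 : 0 ≤ t.re := h0 t hz
  have hzt : z = ((1 - (1 + t.re)⁻¹ : ℝ) : ℂ) := by
    push_cast
    rw [← hB.eq_ofReal hh hz, ht, add_sub_cancel, inv_inv, sub_sub_cancel]
  have hpos : 0 < (1 + t.re)⁻¹ := by positivity
  have hle : (1 + t.re)⁻¹ ≤ 1 := inv_le_one_of_one_le₀ (by linarith)
  rw [← hzr, hzt, Complex.norm_real, Real.norm_of_nonneg (by linarith)]
  linarith

theorem HasRealSpectra.sq_nonneg (hB : HasRealSpectra B) {h : B} (hh : IsSelfAdjoint h) :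
    SpectrumNonneg (h ^ 2) := by
  intro z hz
  rw [spectrum.map_pow] at hz
  obtain ⟨w, hw, rfl : w ^ 2 = z⟩ := hz
  rw [hB.eq_ofReal hh hw]
  exact_mod_cast _root_.sq_nonneg w.re

variable [StarModule ℂ B]

theorem HasRealSpectra.isUnit_one_add_add (hB : HasRealSpectra B) {h k : B}
    (hh : IsSelfAdjoint h) (hk : IsSelfAdjoint k) (h0 : SpectrumNonneg h)
    (k0 : SpectrumNonneg k) : IsUnit (1 + h + k) := by
  obtain ⟨u, hu, hx, hx1⟩ := hB.exists_unit_eq_one_add hh h0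
  obtain ⟨v, hv, hy, hy1⟩ := hB.exists_unit_eq_one_add hk k0
  have hxy : IsUnit (1 - (1 - ↑u⁻¹) * (1 - ↑v⁻¹) : B) :=
    isUnit_one_sub_of_specRad_lt_one ((hB.specRad_mul_le hx hy).trans_lt
      (mul_lt_one_of_nonneg_of_lt_one_left (specRad_nonneg _) hx1 hy1.le))
  have hfactor : 1 + h + k = u * (1 - (1 - ↑u⁻¹) * (1 - ↑v⁻¹)) * v :=
    calc 1 + h + k = u + v - 1 := by rw [hu, hv]; abel
      _ = u * (1 - (1 - ↑u⁻¹) * (1 - ↑v⁻¹)) * v := by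
        simp only [mul_sub, sub_mul, mul_one, one_mul, mul_assoc, Units.inv_mul,
          Units.mul_inv_cancel_left]
        abel
  rw [hfactor]
  exact (u.isUnit.mul hxy).mul v.isUnit

theorem HasRealSpectra.add_nonneg (hB : HasRealSpectra B) {h k : B}
    (hh : IsSelfAdjoint h) (hk : IsSelfAdjoint k) (h0 : SpectrumNonneg h)
    (k0 : SpectrumNonneg k) : SpectrumNonneg (h + k) := by
  intro z hz
  by_contra! hlt
  set c : ℝ := (-z.re)⁻¹ with hc
  have hc0 : 0 < c := inv_pos.2 (neg_pos.2 hlt)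
  have hu : IsUnit (1 + c • (h + k)) := by
    rw [smul_add, ← add_assoc]
    exact hB.isUnit_one_add_add ((IsSelfAdjoint.all c).smul hh) ((IsSelfAdjoint.all c).smul hk)
      (h0.smul hc0) (k0.smul hc0)
  refine (isUnit_one_add_iff_neg_one_notMem (K := ℂ)).1 hu ?_
  rw [← Complex.coe_smul, spectrum.smul_eq_smul _ _ (spectrum.nonempty _)]
  refine ⟨z, hz, ?_⟩
  change (c : ℂ) * z = -1
  rw [hB.eq_ofReal (hh.add hk) hz, ← Complex.ofReal_mul, hc, inv_neg, neg_mul,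
    inv_mul_cancel₀ hlt.ne, Complex.ofReal_neg, Complex.ofReal_one]

theorem HasRealSpectra.one_add_star_mul_self_nonneg (hB : HasRealSpectra B) {b : B}
    (hb : SpectrumNonneg (1 - star b * b)) : SpectrumNonneg (1 + star b * b) := by
  have hre : IsSelfAdjoint (ℜ b : B) := (ℜ b).2
  have him : IsSelfAdjoint (ℑ b : B) := (ℑ b).2
  have hsq := hB.add_nonneg (hre.pow 2) (him.pow 2) (hB.sq_nonneg hre) (hB.sq_nonneg him)
  have hsum := hB.add_nonneg ((IsSelfAdjoint.one B).sub (IsSelfAdjoint.mul_star_self b))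
    ((IsSelfAdjoint.all (2 : ℝ)).smul ((hre.pow 2).add (him.pow 2))) hb.one_sub_mul_comm
    (hsq.smul two_pos)
  rwa [ofNat_smul_eq_nsmul ℝ 2, sq, sq, ← star_mul_self_add_self_mul_star b,
    show 1 - b * star b + (star b * b + b * star b) = 1 + star b * b by abel] at hsum

theorem star_mul_one_sub_pow_mul_self {R : Type*} [Ring R] [StarRing R] (a : R) (n : ℕ) :
    star (a * (1 - star a * a) ^ n) * (a * (1 - star a * a) ^ n) =
      star a * a * (1 - star a * a) ^ (2 * n) := by
  have hc : Commute (star a * a) ((1 - star a * a) ^ n) :=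
    ((Commute.one_right _).sub_right (Commute.refl _)).pow_right n
  calc star (a * (1 - star a * a) ^ n) * (a * (1 - star a * a) ^ n)
      = (1 - star a * a) ^ n * (star a * a) * (1 - star a * a) ^ n := by
        simp only [star_mul, star_pow, star_sub, star_one, star_star, mul_assoc]
    _ = star a * a * (1 - star a * a) ^ (2 * n) := by rw [← hc.eq, mul_assoc, ← pow_add, two_mul]

theorem mul_one_sub_pow_le_one {t : ℝ} (ht : t ≤ 1) (n : ℕ) : t * (1 - t) ^ n ≤ 1 := by
  have hpow : 0 ≤ (1 - t) ^ n := pow_nonneg (by linarith) n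
  rcases le_total t 0 with h | h
  · linarith [mul_nonpos_of_nonpos_of_nonneg h hpow]
  · exact mul_le_one₀ ht hpow (pow_le_one₀ (by linarith) (by linarith))

theorem exists_mul_one_sub_pow_lt_neg_one {t : ℝ} (ht : t < 0) :
    ∃ n : ℕ, t * (1 - t) ^ (2 * n) < -1 := by
  have hlim : Tendsto (fun n : ℕ => (1 - t) ^ (2 * n)) atTop atTop := by
    simp only [pow_mul]
    exact tendsto_pow_atTop_atTop_of_one_lt (by nlinarith)
  exact ((hlim.const_mul_atTop_of_neg ht).eventually_lt_atBot (-1)).exists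

/- Replacing `a` by `a (1 - star a * a) ^ n` keeps the spectrum of `star a * a` below `1` and moves
its negative values to `-∞`, against `one_add_star_mul_self_nonneg`. -/
theorem HasRealSpectra.star_mul_self_nonneg_of_specRad_le_one (hB : HasRealSpectra B) {a : B}
    (ha : specRad (star a * a) ≤ 1) : SpectrumNonneg (star a * a) := by
  set h := star a * a with hh
  have hreal {w : ℂ} (hw : w ∈ spectrum ℂ h) (n : ℕ) :
      w * (1 - w) ^ n = ((w.re * (1 - w.re) ^ n : ℝ) : ℂ) := by
    rw [hB.eq_ofReal (IsSelfAdjoint.star_mul_self a) hw]; simp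
  have hdamped (n : ℕ) : SpectrumNonneg (1 + h * (1 - h) ^ (2 * n)) := by
    rw [hh, ← star_mul_one_sub_pow_mul_self]
    refine hB.one_add_star_mul_self_nonneg fun z hz => ?_
    rw [star_mul_one_sub_pow_mul_self, ← hh, mem_spectrum_one_sub_iff,
      spectrum_mul_one_sub_pow (spectrum.nonempty h)] at hz
    obtain ⟨w, hw, (hwz : w * (1 - w) ^ (2 * n) = 1 - z)⟩ := hz
    have hle := mul_one_sub_pow_le_one
      ((Complex.re_le_norm w).trans ((norm_le_specRad hw).trans ha)) (2 * n)
    rw [← sub_sub_cancel 1 z, ← hwz, hreal hw, Complex.sub_re, Complex.one_re,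
      Complex.ofReal_re]
    exact sub_nonneg.2 hle
  intro z hz
  by_contra! hlt
  obtain ⟨n, hn⟩ := exists_mul_one_sub_pow_lt_neg_one hlt
  have hmem : 1 + z * (1 - z) ^ (2 * n) ∈ spectrum ℂ (1 + h * (1 - h) ^ (2 * n)) := by
    rw [mem_spectrum_one_add_iff, add_sub_cancel_left,
      spectrum_mul_one_sub_pow (spectrum.nonempty h)]
    exact ⟨z, hz, rfl⟩
  have hge := hdamped n _ hmem
  rw [hreal hz, Complex.add_re, Complex.one_re, Complex.ofReal_re] at hge
  linarith

theorem HasRealSpectra.star_mul_self_nonneg (hB : HasRealSpectra B) (a : B) :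
    SpectrumNonneg (star a * a) := by
  set R : ℝ := specRad (star a * a) + 1
  have hR0 : 0 < R := add_pos_of_nonneg_of_pos (specRad_nonneg _) one_pos
  have hscale : star ((√R)⁻¹ • a) * ((√R)⁻¹ • a) = R⁻¹ • (star a * a) := by
    rw [star_smul, star_trivial, smul_mul_smul_comm, ← mul_inv, Real.mul_self_sqrt hR0.le]
  have hle : specRad (R⁻¹ • (star a * a)) ≤ 1 := by
    rw [← Complex.coe_smul, specRad_smul, Complex.norm_of_nonneg (inv_nonneg.2 hR0.le),
      inv_mul_le_iff₀ hR0, mul_one]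
    exact (lt_add_one _).le
  rw [← hscale] at hle
  have hnonneg := (hB.star_mul_self_nonneg_of_specRad_le_one hle).smul hR0
  rwa [hscale, smul_inv_smul₀ hR0.ne'] at hnonneg

end Order

section SpecSup

variable {B : Type*} [NormedRing B] [NormedAlgebra ℂ B]

/-- The largest real part of a spectral value. On the self-adjoint part of an algebra with real
spectra this is the sublinear functional to which the Hahn–Banach theorem is applied. -/
noncomputable def specSup (h : B) : ℝ :=
  sSup (Complex.re '' spectrum ℂ h)

theorem specSup_algebraMap [Nontrivial B] (c : ℂ) : specSup (algebraMap ℂ B c) = c.re := by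
  rw [specSup, spectrum.scalar_eq, Set.image_singleton, csSup_singleton]

variable [CompleteSpace B]

theorem le_specSup {h : B} {z : ℂ} (hz : z ∈ spectrum ℂ h) : z.re ≤ specSup h :=
  le_csSup ((spectrum.isCompact h).image Complex.continuous_re).bddAbove ⟨z, hz, rfl⟩

variable [Nontrivial B]

theorem specSup_le {h : B} {c : ℝ} (hc : ∀ z ∈ spectrum ℂ h, z.re ≤ c) : specSup h ≤ c :=
  csSup_le ((spectrum.nonempty h).image _) (Set.forall_mem_image.2 hc)

theorem specSup_le_specRad (h : B) : specSup h ≤ specRad h :=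
  specSup_le fun z hz => (Complex.re_le_norm z).trans (norm_le_specRad hz)

theorem specSup_neg_le_zero {h : B} (h0 : SpectrumNonneg h) : specSup (-h) ≤ 0 := by
  refine specSup_le fun z hz => ?_
  rw [← spectrum.neg_eq, Set.mem_neg] at hz
  simpa using h0 _ hz

theorem specSup_smul {c : ℝ} (hc : 0 ≤ c) (h : B) : specSup (c • h) = c * specSup h := by
  have himage : Complex.re '' spectrum ℂ (c • h) = c • (Complex.re '' spectrum ℂ h) := by
    rw [← Complex.coe_smul, spectrum.smul_eq_smul _ _ (spectrum.nonempty h)]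
    ext x
    simp [Set.mem_smul_set]
  rw [specSup, himage, Real.sSup_smul_of_nonneg hc, smul_eq_mul, specSup]

variable [StarRing B] [StarModule ℂ B]

theorem HasRealSpectra.specSup_add_le (hB : HasRealSpectra B) {h k : B} (hh : IsSelfAdjoint h)
    (hk : IsSelfAdjoint k) : specSup (h + k) ≤ specSup h + specSup k := by
  have hsa {x : B} (hx : IsSelfAdjoint x) : IsSelfAdjoint (algebraMap ℂ B (specSup x) - x) :=
    (IsSelfAdjoint.algebraMap B (Complex.conj_ofReal _)).sub hx
  have hnonneg (x : B) : SpectrumNonneg (algebraMap ℂ B (specSup x) - x) := fun z hz => by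
    simpa using le_specSup (mem_spectrum_algebraMap_sub_iff.1 hz)
  have hsum := hB.add_nonneg (hsa hh) (hsa hk) (hnonneg h) (hnonneg k)
  rw [sub_add_sub_comm, ← map_add, ← Complex.ofReal_add] at hsum
  refine specSup_le fun z hz => sub_nonneg.1 ?_
  exact hsum _ (mem_spectrum_algebraMap_sub_iff.2 ((sub_sub_cancel _ z).symm ▸ hz))

end SpecSup

section HahnBanach

theorem exists_linearMap_eq_and_le_of_sublinear {E : Type*} [AddCommGroup E] [Module ℝ E]
    {N : E → ℝ} (hsmul : ∀ c : ℝ, 0 ≤ c → ∀ x, N (c • x) = c * N x)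
    (hadd : ∀ x y, N (x + y) ≤ N x + N y) (x : E) :
    ∃ f : E →ₗ[ℝ] ℝ, f x = N x ∧ ∀ y, f y ≤ N y := by
  have hzero : N 0 = 0 := by simpa using hsmul 0 le_rfl 0
  have hwell (c : ℝ) (hc : c • x = 0) : c • N x = 0 := by
    rcases smul_eq_zero.1 hc with rfl | rfl <;> simp [hzero]
  have hspan (c : ℝ) : c * N x ≤ N (c • x) := by
    rcases le_total 0 c with hc | hc
    · exact (hsmul c hc x).ge
    · have hle := hadd (c • x) (-c • x)
      rw [← add_smul, add_neg_cancel, zero_smul, hzero, hsmul (-c) (neg_nonneg.2 hc)] at hle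
      linarith
  obtain ⟨f, hf, hle⟩ := exists_extension_of_le_sublinear
    (LinearPMap.mkSpanSingleton' x (N x) hwell) N (fun c hc => hsmul c hc.le) hadd (by
      rintro ⟨y, hy⟩
      obtain ⟨c, rfl⟩ := Submodule.mem_span_singleton.1 hy
      rw [LinearPMap.mkSpanSingleton'_apply]
      exact hspan c)
  exact ⟨f, (hf ⟨x, Submodule.mem_span_singleton_self x⟩).trans
    (LinearPMap.mkSpanSingleton'_apply_self _ _ _ _), hle⟩

theorem exists_extend_selfAdjoint {E : Type*} [AddCommGroup E] [Module ℂ E] [StarAddMonoid E]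
    [StarModule ℂ E] (f : selfAdjoint E →ₗ[ℝ] ℝ) :
    ∃ φ : E →ₗ[ℂ] ℂ, ∀ h : selfAdjoint E, φ h = f h :=
  ⟨Module.Dual.extendRCLike (𝕜 := ℂ) (f ∘ₗ (realPart : E →ₗ[ℝ] selfAdjoint E)), fun h => by
    simp [Module.Dual.extendRCLike_apply, realPart_I_smul]⟩

variable {B : Type*} [NormedRing B] [NormedAlgebra ℂ B] [CompleteSpace B] [Nontrivial B]
  [StarRing B] [StarModule ℂ B]

theorem HasRealSpectra.exists_linearMap_le_specSup (hB : HasRealSpectra B) {x : B}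
    (hx : IsSelfAdjoint x) : ∃ φ : B →ₗ[ℂ] ℂ, φ x = specSup x ∧
      ∀ h, IsSelfAdjoint h → ∃ t : ℝ, φ h = t ∧ t ≤ specSup h := by
  obtain ⟨f, hfx, hf⟩ := exists_linearMap_eq_and_le_of_sublinear
    (N := fun h : selfAdjoint B => specSup (h : B)) (fun c hc h => specSup_smul hc (h : B))
    (fun h k => hB.specSup_add_le h.2 k.2) ⟨x, hx⟩
  obtain ⟨φ, hφ⟩ := exists_extend_selfAdjoint f
  exact ⟨φ, (hφ ⟨x, hx⟩).trans (congrArg _ hfx), fun h hh => ⟨f ⟨h, hh⟩, hφ ⟨h, hh⟩, hf ⟨h, hh⟩⟩⟩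

theorem HasRealSpectra.specSup_star_mul_self (hB : HasRealSpectra B) (a : B) :
    specSup (star a * a) = specRad (star a * a) := by
  obtain ⟨z, hz, hzr⟩ := exists_norm_eq_specRad (star a * a)
  refine le_antisymm (specSup_le_specRad _) (hzr ▸ ?_)
  rw [hB.eq_ofReal (IsSelfAdjoint.star_mul_self a) hz, Complex.norm_real,
    Real.norm_of_nonneg (hB.star_mul_self_nonneg a z hz)]
  exact le_specSup hz

theorem HasRealSpectra.exists_positiveFunctional (hB : HasRealSpectra B) (a : B) :
    ∃ φ : B →ₗ[ℂ] ℂ, IsPositiveFunctional φ ∧ φ 1 = 1 ∧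
      (∀ h, IsSelfAdjoint h → ‖φ h‖ ≤ specRad h) ∧
      φ (star a * a) = specRad (star a * a) := by
  obtain ⟨φ, hφa, hφ⟩ := hB.exists_linearMap_le_specSup (IsSelfAdjoint.star_mul_self a)
  have hbound {h : B} (hh : IsSelfAdjoint h) :
      ∃ t : ℝ, φ h = t ∧ -specSup (-h) ≤ t ∧ t ≤ specSup h := by
    obtain ⟨t, ht, hle⟩ := hφ h hh
    obtain ⟨s, hs, hsle⟩ := hφ (-h) hh.neg
    have hst : s = -t := by
      rw [map_neg, ht] at hs
      exact_mod_cast hs.symm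
    exact ⟨t, ht, by linarith, hle⟩
  refine ⟨φ, fun b => ?_, ?_, fun h hh => ?_, hB.specSup_star_mul_self a ▸ hφa⟩
  · obtain ⟨t, ht, hge, -⟩ := hbound (IsSelfAdjoint.star_mul_self b)
    rw [ht]
    exact_mod_cast (neg_nonneg.2 (specSup_neg_le_zero (hB.star_mul_self_nonneg b))).trans hge
  · obtain ⟨t, ht, hge, hle⟩ := hbound (IsSelfAdjoint.one B)
    have hone : specSup (1 : B) = 1 := by simpa using specSup_algebraMap (B := B) 1
    have hneg : specSup (-1 : B) = -1 := by simpa using specSup_algebraMap (B := B) (-1)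
    rw [ht]
    exact_mod_cast le_antisymm (hone ▸ hle) (by simpa [hneg] using hge)
  · obtain ⟨t, ht, hge, hle⟩ := hbound hh
    have hneg : specSup (-h) ≤ specRad h := specSup_le fun z hz => by
      rw [← spectrum.neg_eq, Set.mem_neg] at hz
      simpa using (Complex.re_le_norm z).trans (norm_neg z ▸ norm_le_specRad hz)
    rw [ht, Complex.norm_real, Real.norm_eq_abs]
    exact abs_le.2 ⟨(neg_le_neg hneg).trans hge, hle.trans (specSup_le_specRad h)⟩

end HahnBanach

section PositiveFunctionals

variable {A : Type*} [NonUnitalNormedRing A] [NormedSpace ℂ A] [StarRing A]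

theorem sInf_mem_variationBounds {φ : A →ₗ[ℂ] ℂ} (h : (variationBounds φ).Nonempty) :
    sInf (variationBounds φ) ∈ variationBounds φ := by
  have hclosed : IsClosed (variationBounds φ) := by
    simp only [variationBounds, Set.ofPred_and, Set.ofPred_forall]
    exact isClosed_Ici.inter (isClosed_iInter fun a => isClosed_le (by fun_prop) (by fun_prop))
  exact hclosed.csInf_mem h ⟨0, fun v hv => hv.1⟩

theorem variationBounds_smul (φ : A →ₗ[ℂ] ℂ) {c : ℝ} (hc : 0 < c) :
    variationBounds ((c : ℂ) • φ) = c • variationBounds φ := by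
  ext v
  rw [Set.mem_smul_set_iff_inv_smul_mem₀ hc.ne']
  refine and_congr (by simp [hc]) (forall_congr' fun a => ?_)
  simp only [LinearMap.smul_apply, smul_eq_mul, norm_mul, Complex.norm_real, mul_pow,
    Complex.re_ofReal_mul, Real.norm_eq_abs, sq_abs]
  rw [← mul_le_mul_iff_right₀ (pow_pos hc 2) (b := ‖φ a‖ ^ 2)]
  field_simp

theorem IsPositiveFunctional.isState_smul {φ : A →ₗ[ℂ] ℂ} (hφ : IsPositiveFunctional φ)
    (hcont : IsWeaklyContinuousOnSA φ) (hne : (variationBounds φ).Nonempty)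
    (hpos : 0 < sInf (variationBounds φ)) :
    IsState ((((sInf (variationBounds φ))⁻¹ : ℝ) : ℂ) • φ) where
  positive a := mul_nonneg (by exact_mod_cast (inv_pos.2 hpos).le) (hφ a)
  weaklyContinuous b := (hcont b).const_smul _
  finiteVariation := by
    rw [variationBounds_smul φ (inv_pos.2 hpos)]
    exact hne.smul_set
  variation_eq_one := by
    rw [variationBounds_smul φ (inv_pos.2 hpos), Real.sInf_smul_of_nonneg (inv_pos.2 hpos).le,
      smul_eq_mul, inv_mul_cancel₀ hpos.ne']

theorem IsState.norm_sq_le {ψ : A →ₗ[ℂ] ℂ} (hψ : IsState ψ) (a : A) :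
    ‖ψ a‖ ^ 2 ≤ (ψ (star a * a)).re := by
  simpa only [hψ.variation_eq_one, one_mul] using
    (sInf_mem_variationBounds hψ.finiteVariation).2 a

theorem gnSeminorm_nonneg (a : A) : 0 ≤ gnSeminorm a :=
  Real.iSup_nonneg fun _ => Real.sqrt_nonneg _

variable [IsScalarTower ℂ A A] [SMulCommClass ℂ A A]

/-- The functional `a ↦ φ (star b * a * b)`. On a state it is the vector functional of the class of
`b` in the GNS space. -/
def conjFunctional (φ : A →ₗ[ℂ] ℂ) (b : A) : A →ₗ[ℂ] ℂ :=
  φ ∘ₗ LinearMap.mulRight ℂ b ∘ₗ LinearMap.mulLeft ℂ (star b)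

theorem conjFunctional_apply (φ : A →ₗ[ℂ] ℂ) (a b : A) :
    conjFunctional φ b a = φ (star b * a * b) := rfl

theorem conjFunctional_star_mul_self (φ : A →ₗ[ℂ] ℂ) (a b : A) :
    conjFunctional φ b (star a * a) = φ (star (a * b) * (a * b)) := by
  simp only [conjFunctional_apply, star_mul, mul_assoc]

theorem IsPositiveFunctional.conjFunctional {φ : A →ₗ[ℂ] ℂ} (hφ : IsPositiveFunctional φ) (b : A) :
    IsPositiveFunctional (conjFunctional φ b) := fun a => by
  rw [conjFunctional_star_mul_self]
  exact hφ (a * b)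

theorem IsWeaklyContinuousOnSA.conjFunctional {φ : A →ₗ[ℂ] ℂ} (hφ : IsWeaklyContinuousOnSA φ)
    (b : A) : IsWeaklyContinuousOnSA (conjFunctional φ b) := fun c =>
  (hφ (c * b)).congr fun a _ => by simp only [conjFunctional_apply, star_mul, mul_assoc]

variable [StarModule ℂ A]

theorem IsPositiveFunctional.norm_star_mul_sq_le {φ : A →ₗ[ℂ] ℂ} (hφ : IsPositiveFunctional φ)
    (a b : A) : ‖φ (star a * b)‖ ^ 2 ≤ (φ (star a * a)).re * (φ (star b * b)).re := by
  let core : PreInnerProductSpace.Core ℂ A :=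
    { inner x y := φ (star x * y)
      conj_inner_symm x y := hφ.star_mul_conj x y
      re_inner_nonneg x := hφ.re_nonneg x
      add_left x y z := by rw [star_add, add_mul, map_add]
      smul_left x y r := by simp [smul_mul_assoc] }
  have hsymm : ‖φ (star b * a)‖ = ‖φ (star a * b)‖ := by
    rw [← hφ.star_mul_conj, RCLike.norm_conj]
  have hcs : ‖φ (star a * b)‖ * ‖φ (star b * a)‖ ≤ (φ (star a * a)).re * (φ (star b * b)).re :=
    InnerProductSpace.Core.inner_mul_inner_self_le (c := core) a b
  rwa [hsymm, ← sq] at hcs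

theorem IsPositiveFunctional.re_mem_variationBounds_conjFunctional {φ : A →ₗ[ℂ] ℂ}
    (hφ : IsPositiveFunctional φ) (b : A) :
    (φ (star b * b)).re ∈ variationBounds (BanachStar.conjFunctional φ b) := by
  refine ⟨hφ.re_nonneg b, fun a => ?_⟩
  rw [conjFunctional_star_mul_self, conjFunctional_apply, mul_assoc]
  exact hφ.norm_star_mul_sq_le b (a * b)

end PositiveFunctionals

section UniversalRepresentation

variable {A : Type*} [NonUnitalNormedRing A] [NormedSpace ℂ A] [IsScalarTower ℂ A A]
  [SMulCommClass ℂ A A] [StarRing A] [StarModule ℂ A]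

theorem norm_gns_of_sq (ψ : State A) (a : A) :
    ‖(PreGNS.of ψ a : GNS ψ)‖ ^ 2 = (ψ.1 (star a * a)).re := by
  rw [UniformSpace.Completion.norm_coe, PreGNS.norm_sq, LinearEquiv.symm_apply_apply]

/- `ψ (a* a) ^ 2 ≤ ψ ((a* a) ^ 2)` bounds the squared norm of the class of `a` by the norm of its
image under `π_ψ (a*)`, so that no cyclic vector is needed. -/
theorem sqrt_state_le_norm_gnsOp (ψ : State A) (a : A) :
    √(ψ.1 (star a * a)).re ≤ ‖gnsOp ψ a‖ := by
  set x : GNS ψ := (PreGNS.of ψ a : GNS ψ) with hx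
  have hstar : ‖gnsOp ψ (star a)‖ = ‖gnsOp ψ a‖ :=
    (congrArg norm (map_star (gnsRep ψ) a)).trans (norm_star (gnsOp ψ a))
  have hsq : ‖x‖ ^ 2 ≤ ‖gnsOp ψ a‖ * ‖x‖ :=
    calc ‖x‖ ^ 2 ≤ ‖ψ.1 (star a * a)‖ := by
          rw [hx, norm_gns_of_sq]
          exact Complex.re_le_norm _
      _ ≤ ‖gnsOp ψ (star a) x‖ := by
          rw [gnsOp_of, ← sq_le_sq₀ (norm_nonneg _) (norm_nonneg _), norm_gns_of_sq]
          exact ψ.2.norm_sq_le (star a * a)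
      _ ≤ ‖gnsOp ψ a‖ * ‖x‖ := hstar ▸ (gnsOp ψ (star a)).le_opNorm x
  rw [← norm_gns_of_sq, Real.sqrt_sq (norm_nonneg _)]
  rcases (norm_nonneg x).eq_or_lt with h0 | h0
  · rw [← hx, ← h0]
    exact norm_nonneg _
  · exact le_of_mul_le_mul_right (sq ‖x‖ ▸ hsq) h0

theorem sqrt_state_le_gnSeminorm (ψ : State A) (a : A) :
    √(ψ.1 (star a * a)).re ≤ gnSeminorm a := by
  refine le_ciSup (f := fun ψ : State A => √(ψ.1 (star a * a)).re)
    ⟨√(‖star a * a‖ + 1), ?_⟩ ψ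
  rintro _ ⟨ψ, rfl⟩
  exact (sqrt_state_le_norm_gnsOp ψ a).trans
    (ContinuousLinearMap.opNorm_le_bound _ (Real.sqrt_nonneg _) (gnsOp_norm_le ψ a))

theorem IsPositiveFunctional.re_le_mul_gnSeminorm_sq {φ : A →ₗ[ℂ] ℂ} (hφ : IsPositiveFunctional φ)
    (hcont : IsWeaklyContinuousOnSA φ) {v : ℝ} (hv : v ∈ variationBounds φ) (a : A) :
    (φ (star a * a)).re ≤ v * gnSeminorm a ^ 2 := by
  have hmem := sInf_mem_variationBounds ⟨v, hv⟩
  have hle : sInf (variationBounds φ) ≤ v := csInf_le ⟨0, fun v hv => hv.1⟩ hv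
  suffices hinf : (φ (star a * a)).re ≤ sInf (variationBounds φ) * gnSeminorm a ^ 2 from
    hinf.trans (by gcongr)
  rcases hmem.1.eq_or_lt with h0 | hpos
  · have hzero : φ (star a * a) = 0 := by
      have hsq := hmem.2 (star a * a)
      rw [← h0, zero_mul] at hsq
      exact norm_eq_zero.1 (pow_eq_zero_iff two_ne_zero |>.1 (le_antisymm hsq (sq_nonneg _)))
    simp [hzero, ← h0]
  · have hstate := sqrt_state_le_gnSeminorm ⟨_, hφ.isState_smul hcont ⟨v, hv⟩ hpos⟩ a
    rwa [Real.sqrt_le_left (gnSeminorm_nonneg a), LinearMap.smul_apply, smul_eq_mul,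
      Complex.re_ofReal_mul, inv_mul_le_iff₀ hpos] at hstate

theorem norm_gnsOp_apply_le (ψ : State A) (a : A) (x : GNS ψ) :
    ‖gnsOp ψ a x‖ ≤ gnSeminorm a * ‖x‖ := by
  induction x using UniformSpace.Completion.induction_on with
  | hp => exact isClosed_le (by fun_prop) (by fun_prop)
  | ih x =>
    obtain ⟨b, rfl⟩ := (PreGNS.of ψ).surjective x
    rw [gnsOp_of, ← sq_le_sq₀ (norm_nonneg _) (mul_nonneg (gnSeminorm_nonneg a) (norm_nonneg _)),
      mul_pow, norm_gns_of_sq, norm_gns_of_sq, ← conjFunctional_star_mul_self, mul_comm]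
    exact (ψ.2.positive.conjFunctional b).re_le_mul_gnSeminorm_sq
      (ψ.2.weaklyContinuous.conjFunctional b)
      (ψ.2.positive.re_mem_variationBounds_conjFunctional b) a

theorem norm_gnsOp_le_norm_universalRep (ψ : State A) (a : A) :
    ‖gnsOp ψ a‖ ≤ ‖universalRep A a‖ := by
  classical
  refine ContinuousLinearMap.opNorm_le_bound _ (norm_nonneg _) fun x => ?_
  set y : UniversalSpace A := lp.single 2 ψ x with hy
  have happly : universalRep A a y ψ = gnsOp ψ a x := by
    refine (universalOp_apply a y ψ).trans ?_
    rw [hy, lp.single_apply_self]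
    rfl
  calc ‖gnsOp ψ a x‖ = ‖universalRep A a y ψ‖ := by rw [happly]
    _ ≤ ‖universalRep A a y‖ := lp.norm_apply_le_norm two_ne_zero _ ψ
    _ ≤ ‖universalRep A a‖ * ‖y‖ := (universalRep A a).le_opNorm y
    _ = ‖universalRep A a‖ * ‖x‖ := by rw [hy, lp.norm_single (by norm_num)]

theorem norm_universalRep_le {a : A} {C : ℝ} (hC : 0 ≤ C)
    (h : ∀ (ψ : State A) (x : GNS ψ), ‖gnsOp ψ a x‖ ≤ C * ‖x‖) : ‖universalRep A a‖ ≤ C := by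
  refine ContinuousLinearMap.opNorm_le_bound _ hC fun x => ?_
  calc ‖universalRep A a x‖ ≤ ‖(C : ℂ) • x‖ := lp.norm_mono two_ne_zero fun ψ => by
        rw [lp.coeFn_smul, Pi.smul_apply, norm_smul, Complex.norm_real, Real.norm_of_nonneg hC]
        exact h ψ (x ψ)
    _ = C * ‖x‖ := by rw [norm_smul, Complex.norm_real, Real.norm_of_nonneg hC]

theorem norm_universalRep_eq_gnSeminorm (a : A) : ‖universalRep A a‖ = gnSeminorm a :=
  le_antisymm (norm_universalRep_le (gnSeminorm_nonneg a) fun ψ => norm_gnsOp_apply_le ψ a)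
    (Real.iSup_le (fun ψ => (sqrt_state_le_norm_gnsOp ψ a).trans
      (norm_gnsOp_le_norm_universalRep ψ a)) (norm_nonneg _))

end UniversalRepresentation

section UnitElement

theorem isQuasiregular_iff_exists_inverse {R : Type*} [NonUnitalRing R] {e : R}
    (he : ∀ x : R, e * x = x ∧ x * e = x) {x : R} :
    IsQuasiregular x ↔ ∃ y, (e + x) * y = e ∧ y * (e + x) = e := by
  have hmul : ∀ u v : R, (e + u) * (e + v) = e + (v + u + u * v) := fun u v => by
    simp only [add_mul, mul_add, (he _).1, (he _).2]
    abel
  rw [isQuasiregular_iff]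
  constructor
  · rintro ⟨y, hy⟩
    exact ⟨e + y, by simpa only [hmul, add_eq_left] using hy⟩
  · rintro ⟨y, hy⟩
    obtain ⟨w, rfl⟩ : ∃ w, y = e + w := ⟨y - e, by abel⟩
    exact ⟨w, by simpa only [hmul, add_eq_left] using hy⟩

theorem mem_quasispectrum_iff_not_isQuasiregular {A : Type*} [NonUnitalRing A] [Module ℂ A]
    {a : A} {z : ℂ} (hz : z ≠ 0) :
    z ∈ quasispectrum ℂ a ↔ ¬ IsQuasiregular (-(z⁻¹ • a)) := by
  lift z to ℂˣ using hz.isUnit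
  rw [← Units.val_inv_eq_inv_val, ← Units.smul_def]
  exact ⟨fun h => by simpa using h z.isUnit, quasispectrum.mem_of_not_quasiregular a⟩

variable {A : Type*} [NonUnitalNormedRing A] [NormedSpace ℂ A] [IsScalarTower ℂ A A]
  [SMulCommClass ℂ A A]

theorem IsUnitElement.isQuasiregular_iff {e : A} (he : IsUnitElement e) (a : A) {z : ℂ}
    (hz : z ≠ 0) : IsQuasiregular (-(z⁻¹ • a)) ↔
      ∃ b : A, (z • e - a) * b = e ∧ b * (z • e - a) = e := by
  have hfactor : z • e - a = z • (e + -(z⁻¹ • a)) := by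
    rw [smul_add, smul_neg, smul_inv_smul₀ hz, sub_eq_add_neg]
  rw [isQuasiregular_iff_exists_inverse he.2, hfactor]
  constructor
  · rintro ⟨y, hy₁, hy₂⟩
    exact ⟨z⁻¹ • y, by rwa [smul_mul_smul_comm, mul_inv_cancel₀ hz, one_smul],
      by rwa [smul_mul_smul_comm, inv_mul_cancel₀ hz, one_smul]⟩
  · rintro ⟨b, hb₁, hb₂⟩
    exact ⟨z • b, by rwa [mul_smul_comm, ← smul_mul_assoc],
      by rwa [smul_mul_assoc, ← mul_smul_comm]⟩

theorem mem_sp_iff_mem_quasispectrum (a : A) {z : ℂ} (hz : z ≠ 0) :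
    z ∈ sp a ↔ z ∈ quasispectrum ℂ a := by
  by_cases h : ∃ e : A, IsUnitElement e
  · have hunit : ∀ e : A, IsUnitElement e →
        ((¬ ∃ b : A, (z • e - a) * b = e ∧ b * (z • e - a) = e) ↔ z ∈ quasispectrum ℂ a) :=
      fun e he => by
        rw [← he.isQuasiregular_iff a hz, mem_quasispectrum_iff_not_isQuasiregular hz]
    obtain ⟨e, he⟩ := h
    refine ⟨?_, fun hs => Or.inl ⟨e, he, (hunit e he).2 hs⟩⟩
    rintro (⟨e', he', hn⟩ | ⟨hn, -⟩)
    · exact (hunit e' he').1 hn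
    · exact absurd ⟨e, he⟩ hn
  · rw [Unitization.quasispectrum_eq_spectrum_inr]
    exact ⟨fun hs => hs.elim (fun ⟨e, he, _⟩ => absurd ⟨e, he⟩ h) And.right,
      fun hs => Or.inr ⟨h, hs⟩⟩

theorem isHermitianAlgebra_iff [StarRing A] : IsHermitianAlgebra A ↔
    ∀ a : A, IsSelfAdjoint a → ∀ z ∈ spectrum ℂ (a : Unitization ℂ A), z.im = 0 := by
  refine forall₂_congr fun a _ => forall_congr' fun z => ?_
  by_cases hz : z = 0
  · simp [hz]
  · rw [mem_sp_iff_mem_quasispectrum a hz, Unitization.quasispectrum_eq_spectrum_inr]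

end UnitElement

section Unitization

variable {A : Type*} [NonUnitalNormedRing A] [NormedSpace ℂ A] [IsScalarTower ℂ A A]
  [SMulCommClass ℂ A A]

variable (A) in
/-- The unitization `ℂ ⊕ A` with the norm `‖(z, a)‖ = ‖z‖ + ‖a‖`, which makes it a unital Banach
`*`-algebra even when the involution of `A` is not continuous. -/
abbrev UnitizationL1 : Type _ := WithLp 1 (Unitization ℂ A)

instance : Nontrivial (UnitizationL1 A) :=
  (WithLp.equiv 1 (Unitization ℂ A)).nontrivial

noncomputable instance [StarRing A] [StarModule ℂ A] : StarRing (UnitizationL1 A) where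
  star x := WithLp.toLp 1 (star (WithLp.ofLp x))
  star_involutive x := congrArg (WithLp.toLp 1) (star_star (WithLp.ofLp x))
  star_mul x y := congrArg (WithLp.toLp 1) (star_mul (WithLp.ofLp x) (WithLp.ofLp y))
  star_add x y := congrArg (WithLp.toLp 1) (star_add (WithLp.ofLp x) (WithLp.ofLp y))

instance [StarRing A] [StarModule ℂ A] : StarModule ℂ (UnitizationL1 A) where
  star_smul c x := congrArg (WithLp.toLp 1) (star_smul c (WithLp.ofLp x))

/-- The embedding of `A` into `UnitizationL1 A`. -/
noncomputable def inrL1 [StarRing A] [StarModule ℂ A] : A →⋆ₙₐ[ℂ] UnitizationL1 A where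
  toFun a := WithLp.toLp 1 (a : Unitization ℂ A)
  map_smul' c a := congrArg (WithLp.toLp 1) (Unitization.inr_smul ℂ c a)
  map_zero' := congrArg (WithLp.toLp 1) (Unitization.inr_zero ℂ)
  map_add' a b := congrArg (WithLp.toLp 1) (Unitization.inr_add ℂ a b)
  map_mul' a b := congrArg (WithLp.toLp 1) (Unitization.inr_mul ℂ a b)
  map_star' a := congrArg (WithLp.toLp 1) (Unitization.inr_star a)

theorem spectrum_toLp (x : Unitization ℂ A) :
    spectrum ℂ (WithLp.toLp 1 x : UnitizationL1 A) = spectrum ℂ x :=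
  (AlgEquiv.spectrum_eq (WithLp.unitizationAlgEquiv ℂ : UnitizationL1 A ≃ₐ[ℂ] Unitization ℂ A)
    (WithLp.toLp 1 x)).symm

theorem norm_one_unitizationL1 : ‖(1 : UnitizationL1 A)‖ = 1 := by
  change ‖(WithLp.toLp 1 (1 : Unitization ℂ A) : UnitizationL1 A)‖ = 1
  simp [WithLp.unitization_norm_def]

variable [StarRing A] [StarModule ℂ A]

theorem norm_inrL1 (a : A) : ‖inrL1 a‖ = ‖a‖ :=
  WithLp.unitization_norm_inr a

theorem spectrum_inrL1 (a : A) : spectrum ℂ (inrL1 a) = spectrum ℂ (a : Unitization ℂ A) :=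
  spectrum_toLp _

theorem inrL1_powSucc (a : A) (n : ℕ) : inrL1 (powSucc a n) = inrL1 a ^ (n + 1) := by
  induction n with
  | zero => simp only [powSucc, zero_add, pow_one]
  | succ n ih => rw [powSucc, map_mul, ih, pow_succ _ (n + 1)]

theorem IsHermitianAlgebra.hasRealSpectra (hA : IsHermitianAlgebra A) :
    HasRealSpectra (UnitizationL1 A) := by
  rintro ⟨x⟩ hx z hz
  replace hx : star x = x := congrArg WithLp.ofLp hx
  have hfst : x.fst.im = 0 :=
    Complex.conj_eq_iff_im.1 (congrArg (fun y : Unitization ℂ A => y.fst) hx)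
  have hsnd : IsSelfAdjoint x.snd := congrArg (fun y : Unitization ℂ A => y.snd) hx
  rw [spectrum_toLp, ← Unitization.inl_fst_add_inr_snd_eq x, ← Unitization.algebraMap_eq_inl,
    add_comm, ← spectrum.add_singleton_eq] at hz
  obtain ⟨w, hw, _, rfl, rfl⟩ := hz
  rw [Complex.add_im, isHermitianAlgebra_iff.1 hA _ hsnd _ hw, hfst, add_zero]

theorem rLambda_eq_specRad [CompleteSpace A] (a : A) : rLambda a = specRad (inrL1 a) := by
  have hnorm : ∀ n, ‖powSucc a n‖ = ‖inrL1 a ^ (n + 1)‖ := fun n => by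
    rw [← inrL1_powSucc, norm_inrL1]
  apply le_antisymm
  · refine ge_of_tendsto' ((tendsto_norm_pow_root_specRad (inrL1 a)).comp
      (tendsto_add_atTop_nat 1)) fun n => ?_
    have hbdd : BddBelow (Set.range fun n : ℕ => ‖powSucc a n‖ ^ (1 / ((n : ℝ) + 1))) :=
      ⟨0, by rintro _ ⟨n, rfl⟩; positivity⟩
    exact (ciInf_le hbdd n).trans_eq (by rw [Function.comp_apply, ← hnorm, Nat.cast_add_one])
  · refine le_ciInf fun n => ?_
    have hpow := specRad_le_norm_mul (inrL1 a ^ (n + 1))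
    rw [specRad_pow, norm_one_unitizationL1, mul_one, ← hnorm] at hpow
    rw [one_div, Real.le_rpow_inv_iff_of_pos (specRad_nonneg _) (norm_nonneg _) (by positivity)]
    exact_mod_cast hpow

end Unitization

section CStarRepresentations

theorem isSelfAdjoint_aeval {E : Type*} [Ring E] [StarRing E] [Algebra ℂ E] [StarModule ℂ E] {x : E}
    (hx : IsSelfAdjoint x) (q : ℝ[X]) :
    IsSelfAdjoint (aeval x (q.map (algebraMap ℝ ℂ))) := by
  induction q using Polynomial.induction_on' with
  | add p q hp hq => simpa using hp.add hq
  | monomial n c =>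
    rw [map_monomial, aeval_monomial, ← Algebra.smul_def]
    exact IsSelfAdjoint.smul (Complex.conj_ofReal c) (hx.pow n)

theorem norm_aeval_le {D : Type*} [CStarAlgebra D] {T : D} (hT : IsSelfAdjoint T) (q : ℝ[X]) {R : ℝ}
    (hR : 0 ≤ R) (hq : ∀ t : ℝ, |t| ≤ ‖T‖ → |q.eval t| ≤ R) :
    ‖aeval T (q.map (algebraMap ℝ ℂ))‖ ≤ R := by
  cases subsingleton_or_nontrivial D
  · simpa [Subsingleton.elim (aeval T (q.map (algebraMap ℝ ℂ))) 0] using hR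
  rw [aeval_map_algebraMap, ← cfc_polynomial q T hT]
  exact norm_cfc_le hR fun t ht => hq t (spectrum.norm_le_norm_of_mem ht)

theorem apply_eq_aeval_of_inr_eq_aeval {N E : Type*} [NonUnitalRing N] [Module ℂ N]
    [IsScalarTower ℂ N N] [SMulCommClass ℂ N N] [Ring E] [Algebra ℂ E] (f : N →ₙₐ[ℂ] E) {h k : N}
    {q : ℂ[X]} (hk : (k : Unitization ℂ N) = aeval (h : Unitization ℂ N) q) :
    f k = aeval (f h) q := by
  have hlift := congrArg (Unitization.lift f) hk
  rw [← aeval_algHom_apply] at hlift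
  simpa using hlift

variable {A : Type*} [NonUnitalNormedRing A] [NormedSpace ℂ A] [IsScalarTower ℂ A A]
  [SMulCommClass ℂ A A] [StarRing A] [StarModule ℂ A]

theorem exists_inr_eq_aeval {h : A} (hh : IsSelfAdjoint h) {q : ℝ[X]} (hq : q.coeff 0 = 0) :
    ∃ k : A, IsSelfAdjoint k ∧
      (k : Unitization ℂ A) = aeval (h : Unitization ℂ A) (q.map (algebraMap ℝ ℂ)) := by
  set y := aeval (h : Unitization ℂ A) (q.map (algebraMap ℝ ℂ)) with hy
  have hfst : y.fst = 0 := by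
    change Unitization.fstHom ℂ A y = 0
    rw [hy, ← aeval_algHom_apply, Unitization.fstHom_apply, Unitization.fst_inr,
      aeval_map_algebraMap, ← coeff_zero_eq_aeval_zero', hq, map_zero]
  have hinr : (y.snd : Unitization ℂ A) = y := Unitization.ext hfst.symm rfl
  have hsa : IsSelfAdjoint y :=
    isSelfAdjoint_aeval (hh.map (Unitization.inrNonUnitalStarAlgHom ℂ A)) q
  exact ⟨y.snd, congrArg (fun x : Unitization ℂ A => x.snd) hsa, hinr⟩

variable {D : Type*} [CStarAlgebra D] (π : A →⋆ₙₐ[ℂ] D)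

variable [CompleteSpace A]

theorem norm_le_rLambda {a : A} {z : ℂ} (hz : z ∈ spectrum ℂ (a : Unitization ℂ A)) :
    ‖z‖ ≤ rLambda a := by
  rw [rLambda_eq_specRad]
  exact norm_le_specRad (by rwa [spectrum_inrL1])

theorem norm_apply_le_rLambda {h : A} (hh : IsSelfAdjoint h) : ‖π h‖ ≤ rLambda h := by
  rw [← (hh.map π).toReal_spectralRadius_complex_eq_norm, rLambda_eq_specRad]
  refine specRad_le (specRad_nonneg _) fun z hz => norm_le_specRad ?_
  rw [spectrum_inrL1, ← Unitization.quasispectrum_eq_spectrum_inr]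
  exact NonUnitalAlgHom.quasispectrum_apply_subset π h (spectrum_subset_quasispectrum ℂ _ hz)

theorem norm_apply_le_rSigma (a : A) : ‖π a‖ ≤ rSigma a := by
  refine Real.le_sqrt_of_sq_le ?_
  rw [sq, ← CStarRing.norm_star_mul_self, ← map_star, ← map_mul]
  exact norm_apply_le_rLambda π (IsSelfAdjoint.star_mul_self a)

theorem norm_aeval_le_of_rLambda_le (hπ : ∀ k : A, IsSelfAdjoint k → rLambda k ≤ ‖π k‖) {h : A}
    (hh : IsSelfAdjoint h) {q : ℝ[X]} (hq : q.coeff 0 = 0) {R : ℝ}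
    (hR : 0 ≤ R) (hbound : ∀ t : ℝ, |t| ≤ ‖π h‖ → |q.eval t| ≤ R) {z : ℂ}
    (hz : z ∈ spectrum ℂ (h : Unitization ℂ A)) : ‖aeval z q‖ ≤ R := by
  obtain ⟨k, hk, hkq⟩ := exists_inr_eq_aeval hh hq
  have hspec : aeval z q ∈ spectrum ℂ (k : Unitization ℂ A) := by
    have hmem := spectrum.subset_polynomial_aeval (h : Unitization ℂ A)
      (q.map (algebraMap ℝ ℂ)) (Set.mem_image_of_mem _ hz)
    rwa [← hkq, eval_map_algebraMap] at hmem
  calc ‖aeval z q‖ ≤ rLambda k := norm_le_rLambda hspec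
    _ ≤ ‖π k‖ := hπ k hk
    _ ≤ R := by
      rw [show π k = aeval (π h) _ from apply_eq_aeval_of_inr_eq_aeval (π : A →ₙₐ[ℂ] D) hkq]
      exact norm_aeval_le (hh.map π) q hR hbound

theorem isHermitianAlgebra_of_rLambda_le (hπ : ∀ k : A, IsSelfAdjoint k → rLambda k ≤ ‖π k‖) :
    IsHermitianAlgebra A := by
  refine isHermitianAlgebra_iff.2 fun h hh z hz => ?_
  by_contra him
  set c : ℝ := (‖π h‖ + |z.re| + 1)⁻¹ ^ 2 with hc
  have hc0 : 0 < c := by positivity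
  have hincr : 0 < c * z.im ^ 2 := mul_pos hc0 (by positivity)
  have hdamp : ∀ t : ℝ, |t| ≤ ‖π h‖ → |1 - c * (t - z.re) ^ 2| ≤ 1 := fun t ht => by
    have h1 : c * (t - z.re) ^ 2 ≤ 1 := by
      rw [hc, ← mul_pow, sq_le_one_iff_abs_le_one, abs_mul, abs_of_pos (by positivity),
        inv_mul_le_one₀ (by positivity)]
      linarith [abs_sub t z.re]
    exact abs_sub_le_iff.2 ⟨by linarith [mul_nonneg hc0.le (sq_nonneg (t - z.re))], by linarith⟩
  have hgrow : ∀ m : ℕ, ‖z‖ * (1 + c * z.im ^ 2) ^ m ≤ ‖π h‖ := fun m => by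
    have hval : aeval z (X * (1 - C c * (X - C z.re) ^ 2) ^ m) =
        z * ((1 + c * z.im ^ 2 : ℝ) : ℂ) ^ m := by
      have him_sq : (z - z.re) ^ 2 = -(z.im : ℂ) ^ 2 := by
        rw [sub_eq_of_eq_add' (Complex.re_add_im z).symm, mul_pow, Complex.I_sq, mul_neg_one]
      simp [him_sq]
    rw [← abs_of_pos (add_pos one_pos hincr), ← Real.norm_eq_abs,
      ← Complex.norm_real, ← norm_pow, ← norm_mul, ← hval]
    refine norm_aeval_le_of_rLambda_le π hπ hh (by simp) (norm_nonneg _) (fun t ht => ?_) hz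
    simp only [eval_mul, eval_X, eval_pow, eval_sub, eval_one, eval_C, abs_mul, abs_pow]
    exact (mul_le_of_le_one_right (abs_nonneg t)
      (pow_le_one₀ (abs_nonneg _) (hdamp t ht))).trans ht
  obtain ⟨m, hm⟩ := pow_unbounded_of_one_lt (‖π h‖ / ‖z‖) (lt_add_of_pos_right 1 hincr)
  have hz0 : 0 < ‖z‖ := norm_pos_iff.2 fun h0 => him (by rw [h0, Complex.zero_im])
  rw [div_lt_iff₀' hz0] at hm
  exact (hgrow m).not_gt hm

end CStarRepresentations

section RaikovCriterion

theorem isWeaklyContinuousOnSA_of_norm_le {A : Type*} [NonUnitalNormedRing A] [NormedSpace ℂ A]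
    [StarRing A] {φ : A →ₗ[ℂ] ℂ} (hφ : ∀ h : A, IsSelfAdjoint h → ‖φ h‖ ≤ ‖h‖) :
    IsWeaklyContinuousOnSA φ := fun b => by
  have hlip : LipschitzOnWith (‖star b‖₊ * ‖b‖₊) (fun a : A => φ (star b * a * b))
      {a : A | IsSelfAdjoint a} := .of_dist_le_mul fun x hx y hy => by
    rw [dist_eq_norm, dist_eq_norm, ← map_sub, ← sub_mul, ← mul_sub]
    calc ‖φ (star b * (x - y) * b)‖ ≤ ‖star b * (x - y) * b‖ :=
          hφ _ ((hx.sub hy).conjugate' b)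
      _ ≤ ‖star b‖ * ‖x - y‖ * ‖b‖ := norm_mul₃_le
      _ = ‖star b‖ * ‖b‖ * ‖x - y‖ := mul_right_comm _ _ _
  exact hlip.continuousOn

variable {A : Type*} [NonUnitalNormedRing A] [NormedSpace ℂ A] [IsScalarTower ℂ A A]
  [SMulCommClass ℂ A A] [StarRing A] [StarModule ℂ A] [CompleteSpace A]

theorem IsHermitianAlgebra.rSigma_le_gnSeminorm (hA : IsHermitianAlgebra A) (a : A) :
    rSigma a ≤ gnSeminorm a := by
  obtain ⟨φ, hφ, hφ1, hbound, hattained⟩ := hA.hasRealSpectra.exists_positiveFunctional (inrL1 a)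
  let ψ : A →ₗ[ℂ] ℂ := φ ∘ₗ LinearMapClass.linearMap inrL1
  have hψ_star_mul (b : A) : ψ (star b * b) = φ (star (inrL1 b) * inrL1 b) := by
    rw [← map_star, ← map_mul]
    rfl
  have hψ : IsPositiveFunctional ψ := fun b => (hψ_star_mul b).symm ▸ hφ (inrL1 b)
  have hcont : IsWeaklyContinuousOnSA ψ := isWeaklyContinuousOnSA_of_norm_le fun h hh =>
    calc ‖ψ h‖ ≤ specRad (inrL1 h) := hbound _ (hh.map inrL1)
      _ ≤ ‖h‖ := by
        simpa [norm_one_unitizationL1, norm_inrL1] using specRad_le_norm_mul (inrL1 h)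
  have hvar : 1 ∈ variationBounds ψ := ⟨zero_le_one, fun b => by
    simpa [hψ_star_mul, hφ1, ψ] using hφ.norm_star_mul_sq_le 1 (inrL1 b)⟩
  have hval : (ψ (star a * a)).re = rLambda (star a * a) := by
    rw [hψ_star_mul, hattained, Complex.ofReal_re, rLambda_eq_specRad, map_mul, map_star]
  refine Real.sqrt_le_iff.2 ⟨gnSeminorm_nonneg a, ?_⟩
  simpa only [hval, one_mul] using hψ.re_le_mul_gnSeminorm_sq hcont hvar a

theorem IsHermitianAlgebra.gnSeminorm_eq_rSigma (hA : IsHermitianAlgebra A) (a : A) :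
    gnSeminorm a = rSigma a :=
  le_antisymm ((norm_universalRep_eq_gnSeminorm a).symm.trans_le
    (norm_apply_le_rSigma (universalRep A) a)) (hA.rSigma_le_gnSeminorm a)

theorem rSigma_eq_rLambda {k : A} (hk : IsSelfAdjoint k) : rSigma k = rLambda k := by
  rw [rSigma, hk.star_eq, rLambda_eq_specRad, rLambda_eq_specRad, map_mul, ← sq, specRad_pow,
    Real.sqrt_sq (specRad_nonneg _)]

end RaikovCriterion

end BanachStar

theorem mainTheorem3 {A : Type*} [NonUnitalNormedRing A] [NormedSpace ℂ A] [IsScalarTower ℂ A A]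
    [SMulCommClass ℂ A A] [StarRing A] [StarModule ℂ A] [CompleteSpace A] :
    List.TFAE
      [BanachStar.IsHermitianAlgebra A,
        ∀ a : A, ‖BanachStar.universalRep A a‖ = BanachStar.rSigma a,
        ∀ a : A, BanachStar.gnSeminorm a = BanachStar.rSigma a] := by
  tfae_have 1 → 3 := fun hA a => hA.gnSeminorm_eq_rSigma a
  tfae_have 3 → 2 := fun h a => (BanachStar.norm_universalRep_eq_gnSeminorm a).trans (h a)
  tfae_have 2 → 1 := fun h =>
    BanachStar.isHermitianAlgebra_of_rLambda_le (BanachStar.universalRep A) fun k hk =>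
      ((h k).trans (BanachStar.rSigma_eq_rLambda hk)).ge
  tfae_finish
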